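/- Let $f\colon\mathbb{R}^n\to\mathbb{R}$ be differentiable with $L$-Lipschitz gradient ($L>0$), and suppose $\nu = e^{-f}\,dx$ is a probability measure on $\mathbb{R}^n$. For a step size $\epsilon>0$, the Proximal Langevin Algorithm (PLA) is the recursion $$x_{k+1} = x_k - \epsilon \nabla f(x_{k+1}) + \sqrt{2\epsilon}\, z_k,$$ where $z_k\sim\mathcal N(0,I)$ is independent of $(x_0,\dots,x_k)$, and $x_0$ is an arbitrary random variable; let $\rho_k$ be the law of $x_k$. Let the probability measure $\nu_\epsilon$ be the biased limit of PLA, that is, the weak limit of the laws of the iterates of PLA started from some initial law. For probability measures $\rho,\mu$ and $q>1$ let $$R_{q,\mu}(\rho)=\frac1{q-1}\log\int\Big(\frac{d\rho}{d\mu}\Big)^q d\mu\in[0,\infty]$$ ($=\infty$ if $\rho\not\ll\mu$) be the Rényi divergence. The measure $\mu$ satisfies the log-Sobolev inequality (LSI) with constant $\beta>0$ if $$\int \log\frac{d\rho}{d\mu}\,d\rho \le \frac1{2\beta}\int \Big\|\nabla\log\frac{d\rho}{d\mu}\Big\|^2 d\rho$$ for every probability measure $\rho$ with finite second moment and with a smooth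 density $d\rho/d\mu$. Assume that $\nu_\epsilon$ satisfies LSI with constant $\beta>0$, that $0<\epsilon<\min\{\frac1L,\frac1{2\beta}\}$, and that $q>1$. Then along PLA, for all $k\ge 0$, $$R_{q,\nu}(\rho_k)\le\Big(\frac{q-\frac12}{q-1}\Big)R_{2q,\nu_\epsilon}(\rho_0)\,e^{-\frac{\beta\epsilon k}{2q}}+R_{2q-1,\nu}(\nu_\epsilon).$$ -/

import Mathlib

open MeasureTheory ProbabilityTheory Filter Topology
open scoped ENNReal BoundedContinuousFunction

noncomputable section

/-- The measure `e^{-f(x)} dx` on `ℝⁿ`. -/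
def gibbs {n : ℕ} (f : EuclideanSpace ℝ (Fin n) → ℝ) : Measure (EuclideanSpace ℝ (Fin n)) :=
  volume.withDensity fun x => ENNReal.ofReal (Real.exp (-f x))

/-- `e^{-f}` is `L`-smooth: `f` is differentiable and its gradient is `L`-Lipschitz. -/
def IsSmooth {n : ℕ} (f : EuclideanSpace ℝ (Fin n) → ℝ) (L : ℝ) : Prop :=
  Differentiable ℝ f ∧ ∀ x y, ‖gradient f x - gradient f y‖ ≤ L * ‖x - y‖

/-- The relative Fisher information `J_ν(ρ) = ∫ ‖∇ log (ρ/ν)‖² dρ` of `ρ = h ν`, where `h = ρ/ν`.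
The points with `h = 0` do not contribute, as they form a null set of `ρ`. -/
def fisherInfo {n : ℕ} (ν : Measure (EuclideanSpace ℝ (Fin n)))
    (h : EuclideanSpace ℝ (Fin n) → ℝ) : ℝ≥0∞ :=
  ∫⁻ x, ‖gradient (fun y => Real.log (h y)) x‖ₑ ^ 2
    ∂(ν.withDensity fun x => ENNReal.ofReal (h x))

/-- The log-Sobolev inequality with constant `α > 0`: `H_ν(ρ) ≤ J_ν(ρ) / (2α)` for all probability
measures `ρ` with finite second moment and smooth density `h = ρ/ν`. -/
def LogSobolev {n : ℕ} (ν : Measure (EuclideanSpace ℝ (Fin n))) (α : ℝ) : Prop :=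
  0 < α ∧ ∀ h : EuclideanSpace ℝ (Fin n) → ℝ, ContDiff ℝ (⊤ : ℕ∞) h → (∀ x, 0 ≤ h x) →
    IsProbabilityMeasure (ν.withDensity fun x => ENNReal.ofReal (h x)) →
    Integrable (fun x => ‖x‖ ^ 2) (ν.withDensity fun x => ENNReal.ofReal (h x)) →
    InformationTheory.klDiv (ν.withDensity fun x => ENNReal.ofReal (h x)) ν
      ≤ ENNReal.ofReal (1 / (2 * α)) * fisherInfo ν h

open scoped Classical in
/-- The Rényi divergence `R_{q,ν}(ρ) = (q - 1)⁻¹ log ∫ (dρ/dν)^q dν` of order `q > 1` of `ρ` with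
respect to `ν`, with values in the extended reals (it is `∞` if `ρ` is not absolutely continuous
with respect to `ν`, or if the integral is infinite). -/
def renyiDiv {n : ℕ} (q : ℝ) (ν ρ : Measure (EuclideanSpace ℝ (Fin n))) : EReal :=
  if ρ ≪ ν then ((1 / (q - 1) : ℝ) : EReal) * ENNReal.log (∫⁻ x, ρ.rnDeriv ν x ^ q ∂ν) else ⊤

/-- `x` is a run of the Proximal Langevin Algorithm for `f` with step size `ε`, driven by the noise
`z`: the noise `z k` is standard Gaussian and independent of the past `(x 0, …, x k)`, and
`x (k+1) = x k - ε ∇f(x (k+1)) + √(2ε) z k` almost surely. -/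
structure IsPLA {n : ℕ} (f : EuclideanSpace ℝ (Fin n) → ℝ) (ε : ℝ) {Ω : Type*} [MeasurableSpace Ω]
    (P : Measure Ω) (x z : ℕ → Ω → EuclideanSpace ℝ (Fin n)) : Prop where
  measurable_iterate : ∀ k, Measurable (x k)
  measurable_noise : ∀ k, Measurable (z k)
  law_noise : ∀ k, P.map (z k) = stdGaussian (EuclideanSpace ℝ (Fin n))
  indep_noise : ∀ k, IndepFun (fun w (j : Fin (k + 1)) => x j w) (z k) P
  step : ∀ k, ∀ᵐ w ∂P,
    x (k + 1) w = x k w - ε • gradient f (x (k + 1) w) + Real.sqrt (2 * ε) • z k w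

/-- `νε` is a (biased) limit of the Proximal Langevin Algorithm with step size `ε`: the laws of the
iterates of some run (that is, from some initial distribution) converge weakly to `νε`. -/
def IsBiasedLimit {n : ℕ} (f : EuclideanSpace ℝ (Fin n) → ℝ) (ε : ℝ)
    (νε : Measure (EuclideanSpace ℝ (Fin n))) : Prop :=
  ∃ (Ω : Type) (_ : MeasurableSpace Ω) (P : Measure Ω) (_ : IsProbabilityMeasure P)
    (x z : ℕ → Ω → EuclideanSpace ℝ (Fin n)), IsPLA f ε P x z ∧
    ∀ g : EuclideanSpace ℝ (Fin n) →ᵇ ℝ,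
      Tendsto (fun k => ∫ y, g y ∂(P.map (x k))) atTop (𝓝 (∫ y, g y ∂νε))

end

/-! Write `T y = y + ε ∇f(y)`. A step of PLA says that `T` pushes the law of `x (k+1)` to the law of
`x k` smoothed by `N(0, 2εI)`. Passing to the weak limit, `νε` satisfies the same relation with
itself on both sides. Since `εL < 1`, `T` is injective, so moments of relative densities are
unchanged by `T`. It remains to show that `∫ (dρ/dμ)^Q dμ` contracts when `ρ` and `μ = νε` are
smoothed by the same Gaussian.

The contraction comes from hypercontractivity and duality. Let `P_t` be the heat semigroup with
generator `Δ`, let `ν_t` be `ν` smoothed for time `t`, and let `u_t = P_{T-t} g` be the backward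
flow. In the time derivative of `∫ Ψ(t, u_t) dν_t` the Laplacians cancel and only `∫ (∂_tΨ + Ψ''
‖∇u‖²) dν_t` remains (`hasDerivAt_integral_flow`). With `Ψ = u log u` this shows that a log-Sobolev
inequality with factor `c` for `ν` gives the factor `c + t` for `ν_t`. With `Ψ = u ^ p(t)`, where `p
- 1` is proportional to `1 / (c + t)`, Gross's argument makes the `L^{p(t)}(ν_t)` norm of `u_t`
nondecreasing, so `P_T` is bounded by `1` from `L^r(ν_T)` to `L^s(ν)` for some `s > r`
(`C1LogSobolev.hypercontractive`).

Dually, the `L^Q` norm of the smoothed density is at most the `L^a` norm of the original density,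
for some `a < Q`. Interpolating `L^a` between `L^1`, where a density has norm one, and `L^Q` bounds
the new moment by the old one to the power `Q / (Q + T/c)`
(`C1LogSobolev.lintegral_rnDeriv_gaussConv_le`). For `T = ε` and `c = 1/(2β)` this exponent is at
most `exp(-βε/Q)`. Iterating with `Q = 2q` gives the decay relative to `νε`, and Cauchy–Schwarz
(`lintegral_rnDeriv_rpow_le_mul`) passes from `νε` to the target at the cost of the bias term.

Only test functions are differentiated, never the densities of the iterates, so the initial law may
be arbitrary. The test functions are bounded, bounded away from zero and `C²`. The assumed
log-Sobolev inequality, stated for smooth densities with finite second moment, is first extended to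
such functions by Gaussian weights and mollification. -/

/-! ### Gaussian integration by parts. -/

section GaussianCalculus

variable {E : Type*} [NormedAddCommGroup E] [InnerProductSpace ℝ E] [FiniteDimensional ℝ E]
  [MeasurableSpace E] [BorelSpace E]
set_option linter.unusedSectionVars false
set_option maxSynthPendingDepth 3
variable {F : Type*} [NormedAddCommGroup F] [NormedSpace ℝ F]

/-- Differentiation under the average of a function over random translations. -/
theorem hasFDerivAt_integral_translate {Ω : Type*} [MeasurableSpace Ω] (P : Measure Ω)
    [IsProbabilityMeasure P] {c : Ω → E} (hc : Measurable c) {g : E → F} {g' : E → E →L[ℝ] F}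
    (hg : ∀ x, HasFDerivAt g (g' x) x) (hg' : Continuous g') {C M : ℝ} (hC : ∀ x, ‖g x‖ ≤ C)
    (hM : ∀ x, ‖g' x‖ ≤ M) (x : E) :
    HasFDerivAt (fun x => ∫ ω, g (x + c ω) ∂P) (∫ ω, g' (x + c ω) ∂P) x := by
  have hgc : Continuous g := continuous_iff_continuousAt.2 fun x => (hg x).continuousAt
  have hm : ∀ x, AEStronglyMeasurable (fun ω => g (x + c ω)) P := fun x =>
    (hgc.stronglyMeasurable.comp_measurable (measurable_const.add hc)).aestronglyMeasurable
  refine hasFDerivAt_integral_of_dominated_of_fderiv_le (bound := fun _ => M)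
    (F' := fun x ω => g' (x + c ω)) Filter.univ_mem
    (Eventually.of_forall hm) ?_ ?_ ?_ (integrable_const _) ?_
  · exact Integrable.of_bound (hm x) C (Eventually.of_forall fun ω => hC _)
  · exact (hg'.stronglyMeasurable.comp_measurable (measurable_const.add hc)).aestronglyMeasurable
  · exact Eventually.of_forall fun ω x _ => hM _
  · exact Eventually.of_forall fun ω x _ => by
      have h := (hg (x + c ω)).comp x ((hasFDerivAt_id x).add_const (c ω))
      rw [ContinuousLinearMap.comp_id] at h
      exact h

theorem integrable_norm_stdGaussian : Integrable (fun z : E => ‖z‖) (stdGaussian E) :=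
  IsGaussian.integrable_id.norm

theorem integrable_norm_sq_stdGaussian : Integrable (fun z : E => ‖z‖ ^ 2) (stdGaussian E) :=
  (IsGaussian.memLp_two_id (μ := stdGaussian E)).integrable_norm_pow (by norm_num)

/-- The sum of independent centred Gaussians is Gaussian and the variances add up. -/
theorem stdGaussian_prod_map_smul_add_smul {a b c : ℝ} (h : a ^ 2 + b ^ 2 = c ^ 2) :
    ((stdGaussian E).prod (stdGaussian E)).map (fun p => a • p.1 + b • p.2)
      = (stdGaussian E).map (fun z => c • z) := by
  have e1 : (fun p : E × E => a • p.1 + b • p.2)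
      = ⇑(a • ContinuousLinearMap.fst ℝ E E + b • ContinuousLinearMap.snd ℝ E E) := by
    ext p; simp
  have e2 : (fun z : E => c • z) = ⇑(c • ContinuousLinearMap.id ℝ E) := by ext p; simp
  rw [e1, e2]
  refine Measure.ext_of_charFunDual ?_
  ext L
  rw [charFunDual_map, charFunDual_map, charFunDual_prod, charFunDual_stdGaussian,
    charFunDual_stdGaussian, charFunDual_stdGaussian, ← Complex.exp_add]
  have h1 : (L.comp (a • ContinuousLinearMap.fst ℝ E E + b • ContinuousLinearMap.snd ℝ E E)).comp
      (.inl ℝ E E) = a • L := by ext x; simp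
  have h2 : (L.comp (a • ContinuousLinearMap.fst ℝ E E + b • ContinuousLinearMap.snd ℝ E E)).comp
      (.inr ℝ E E) = b • L := by ext x; simp
  have h3 : L.comp (c • ContinuousLinearMap.id ℝ E) = c • L := by ext x; simp
  rw [h1, h2, h3, norm_smul, norm_smul, norm_smul]
  congr 1
  norm_cast
  simp only [mul_pow, Real.norm_eq_abs, sq_abs, ← h]
  ring

/-- With `L` represented by a vector, this is the covariance form of the centred standard Gaussian,
which is the inner product. -/
theorem integral_inner_mul_stdGaussian (L : E →L[ℝ] ℝ) (v : E) :
    ∫ z, L z * inner ℝ z v ∂(stdGaussian E) = L v := by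
  obtain ⟨w, rfl⟩ := (InnerProductSpace.toDual ℝ E).surjective L
  have h := covarianceBilin_apply_eq_cov (μ := stdGaussian E) IsGaussian.memLp_two_id w v
  rw [covarianceBilin_stdGaussian, covariance] at h
  have h0 : ∀ u : E, ∫ z, inner ℝ u z ∂(stdGaussian E) = 0 := fun u =>
    integral_strongDual_stdGaussian (innerSL ℝ u)
  simp only [h0, sub_zero] at h
  rw [innerSL_apply_apply] at h
  simpa [real_inner_comm] using h.symm

/-- Gaussian integration by parts (Stein's identity). -/
theorem integral_inner_mul_eq_integral_fderiv {φ : E → ℝ} {φ' : E → E →L[ℝ] ℝ}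
    (hφ : ∀ x, HasFDerivAt φ (φ' x) x) (hφ' : Continuous φ') {M : ℝ} (hM : ∀ x, ‖φ x‖ ≤ M)
    (hM' : ∀ x, ‖φ' x‖ ≤ M) (v : E) :
    ∫ z, φ z * inner ℝ z v ∂(stdGaussian E) = ∫ z, φ' z v ∂(stdGaussian E) := by
  have hφc : Continuous φ := continuous_iff_continuousAt.2 fun x => (hφ x).continuousAt
  have hM0 : 0 ≤ M := (norm_nonneg _).trans (hM 0)
  set γ := stdGaussian E
  -- For an independent Gaussian pair `p`, the rotated pair `(Y θ, W θ)` has the same law for every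
  -- angle, so the expectation of `G θ` is constant. Its vanishing derivative at `θ = 0` is the mean
  -- of `φ'(p.1)(p.2) ⟨p.2, v⟩ - φ(p.1) ⟨p.1, v⟩`; integrating out `p.2` gives Stein's identity.
  let Y : ℝ → E × E → E := fun θ p => Real.cos θ • p.1 + Real.sin θ • p.2
  let W : ℝ → E × E → E := fun θ p => -Real.sin θ • p.1 + Real.cos θ • p.2
  let G : ℝ → E × E → ℝ := fun θ p => φ (Y θ p) * inner ℝ (W θ p) v
  let G' : ℝ → E × E → ℝ := fun θ p =>
    φ' (Y θ p) (W θ p) * inner ℝ (W θ p) v + φ (Y θ p) * inner ℝ (-Y θ p) v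
  have hYc : ∀ θ, Continuous (Y θ) := fun θ => by fun_prop
  have hWc : ∀ θ, Continuous (W θ) := fun θ => by fun_prop
  have hYn : ∀ θ p, ‖Y θ p‖ ≤ ‖p.1‖ + ‖p.2‖ := fun θ p => by
    refine (norm_add_le _ _).trans ?_
    rw [norm_smul, norm_smul]
    gcongr
    · exact mul_le_of_le_one_left (norm_nonneg _) (Real.abs_cos_le_one _)
    · exact mul_le_of_le_one_left (norm_nonneg _) (Real.abs_sin_le_one _)
  have hWn : ∀ θ p, ‖W θ p‖ ≤ ‖p.1‖ + ‖p.2‖ := fun θ p => by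
    refine (norm_add_le _ _).trans ?_
    rw [norm_smul, norm_smul, norm_neg]
    gcongr
    · exact mul_le_of_le_one_left (norm_nonneg _) (Real.abs_sin_le_one _)
    · exact mul_le_of_le_one_left (norm_nonneg _) (Real.abs_cos_le_one _)
  have hYd : ∀ θ p, HasDerivAt (fun θ => Y θ p) (W θ p) θ := fun θ p =>
    ((Real.hasDerivAt_cos θ).smul_const p.1).add ((Real.hasDerivAt_sin θ).smul_const p.2)
  have hWd : ∀ θ p, HasDerivAt (fun θ => W θ p) (-Y θ p) θ := fun θ p => by
    have := ((Real.hasDerivAt_sin θ).neg.smul_const p.1).add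
      ((Real.hasDerivAt_cos θ).smul_const p.2)
    refine this.congr_deriv ?_
    simp only [Y, neg_smul, neg_add]
  have i1 : Integrable (fun p : E × E => ‖p.1‖) (γ.prod γ) := integrable_norm_stdGaussian.comp_fst γ
  have i2 : Integrable (fun p : E × E => ‖p.2‖) (γ.prod γ) := integrable_norm_stdGaussian.comp_snd γ
  have i3 : Integrable (fun p : E × E => ‖p.1‖ ^ 2) (γ.prod γ) :=
    integrable_norm_sq_stdGaussian.comp_fst γ
  have i4 : Integrable (fun p : E × E => ‖p.2‖ ^ 2) (γ.prod γ) :=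
    integrable_norm_sq_stdGaussian.comp_snd γ
  have hGc : ∀ θ, Continuous (G θ) := fun θ => by
    have := hYc θ; have := hWc θ; fun_prop
  have hG'c : ∀ θ, Continuous (G' θ) := fun θ => by
    have := hYc θ; have := hWc θ; fun_prop
  have hGb : ∀ θ p, ‖G θ p‖ ≤ M * ((‖p.1‖ + ‖p.2‖) * ‖v‖) := fun θ p => by
    rw [norm_mul]
    gcongr
    · exact hM _
    · exact (norm_inner_le_norm _ _).trans (by gcongr; exact hWn θ p)
  have hder := hasDerivAt_integral_of_dominated_loc_of_deriv_le (μ := γ.prod γ) (F := G) (F' := G')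
    (x₀ := 0) (s := Set.univ) (𝕜 := ℝ)
    (bound := fun p => M * (2 * (‖p.1‖ ^ 2 + ‖p.2‖ ^ 2)) * ‖v‖ + M * ((‖p.1‖ + ‖p.2‖) * ‖v‖))
    Filter.univ_mem (Eventually.of_forall fun θ => (hGc θ).aestronglyMeasurable)
    (((i1.add i2).mul_const ‖v‖ |>.const_mul M).mono' (hGc 0).aestronglyMeasurable
      (Eventually.of_forall (hGb 0)))
    (hG'c 0).aestronglyMeasurable
    (Eventually.of_forall fun p θ _ => by
      refine (norm_add_le _ _).trans (add_le_add ?_ ?_)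
      · rw [norm_mul]
        calc ‖φ' (Y θ p) (W θ p)‖ * ‖inner ℝ (W θ p) v‖
            ≤ (M * (‖p.1‖ + ‖p.2‖)) * ((‖p.1‖ + ‖p.2‖) * ‖v‖) := by
              gcongr
              · exact ((φ' _).le_opNorm _).trans (by gcongr; exacts [hM' _, hWn θ p])
              · exact (norm_inner_le_norm _ _).trans (by gcongr; exact hWn θ p)
          _ = M * (‖p.1‖ + ‖p.2‖) ^ 2 * ‖v‖ := by ring
          _ ≤ _ := by gcongr; nlinarith [sq_nonneg (‖p.1‖ - ‖p.2‖)]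
      · rw [norm_mul]
        gcongr
        · exact hM _
        · exact (norm_inner_le_norm _ _).trans (by rw [norm_neg]; gcongr; exact hYn θ p))
    ((((i3.add i4).const_mul 2).const_mul M |>.mul_const _).add
      ((i1.add i2).mul_const ‖v‖ |>.const_mul M))
    (Eventually.of_forall fun p θ _ => by
      have h1 : HasDerivAt (fun θ => φ (Y θ p)) (φ' (Y θ p) (W θ p)) θ :=
        (hφ _).comp_hasDerivAt θ (hYd θ p)
      have h2 : HasDerivAt (fun θ => inner ℝ (W θ p) v) (inner ℝ (-Y θ p) v) θ := by
        simpa using (hWd θ p).inner ℝ (hasDerivAt_const θ v)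
      exact h1.mul h2)
  have hconst : ∀ θ, ∫ p, G θ p ∂(γ.prod γ) = ∫ p, φ p.1 * inner ℝ p.2 v ∂(γ.prod γ) := fun θ => by
    have hrot := IsGaussian.map_rotation_eq_self (μ := γ) (by simp [γ]) θ
    have hm : ∫ p, φ p.1 * inner ℝ p.2 v ∂((γ.prod γ).map (ContinuousLinearMap.rotation θ))
        = ∫ p, G θ p ∂(γ.prod γ) := by
      rw [integral_map (by fun_prop) (Continuous.aestronglyMeasurable (by fun_prop))]
      rfl
    rw [← hm, hrot]
  have hz : ∫ p, G' 0 p ∂(γ.prod γ) = 0 := by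
    have := hder.2
    simp only [hconst] at this
    exact this.unique (hasDerivAt_const _ _)
  have hG'0 : G' 0 = fun p => φ' p.1 p.2 * inner ℝ p.2 v - φ p.1 * inner ℝ p.1 v := by
    ext p; simp [G', Y, W]; ring
  rw [hG'0] at hz
  have j1 : Integrable (fun z => φ z * inner ℝ z v) γ :=
    ((integrable_norm_stdGaussian.mul_const ‖v‖).const_mul M).mono'
      (Continuous.aestronglyMeasurable (by fun_prop)) (Eventually.of_forall fun z => by
        rw [norm_mul]; gcongr; exacts [hM _, norm_inner_le_norm _ _])
  have j2 : Integrable (fun p : E × E => φ' p.1 p.2 * inner ℝ p.2 v) (γ.prod γ) :=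
    ((i4.mul_const ‖v‖).const_mul M).mono'
      (Continuous.aestronglyMeasurable (by fun_prop)) (Eventually.of_forall fun p => by
        rw [norm_mul]
        calc _ ≤ (M * ‖p.2‖) * (‖p.2‖ * ‖v‖) := by
              gcongr
              · exact ((φ' _).le_opNorm _).trans (by gcongr; exact hM' _)
              · exact norm_inner_le_norm _ _
          _ = _ := by ring)
  rw [integral_sub j2 (j1.comp_fst γ), integral_prod _ j2, integral_prod _ (j1.comp_fst γ)] at hz
  simp only [integral_const, probReal_univ, one_smul, γ, integral_inner_mul_stdGaussian] at hz
  exact (sub_eq_zero.1 hz).symm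

/-- The trace of a bilinear form in an orthonormal basis. -/
noncomputable def bilinTrace (B : E →L[ℝ] E →L[ℝ] ℝ) : ℝ :=
  ∑ i, B (stdOrthonormalBasis ℝ E i) (stdOrthonormalBasis ℝ E i)

theorem continuous_bilinTrace : Continuous (bilinTrace : (E →L[ℝ] E →L[ℝ] ℝ) → ℝ) := by
  unfold bilinTrace; fun_prop

theorem norm_bilinTrace_le (B : E →L[ℝ] E →L[ℝ] ℝ) :
    ‖bilinTrace B‖ ≤ Module.finrank ℝ E * ‖B‖ := by
  refine (norm_sum_le _ _).trans ?_
  refine (Finset.sum_le_card_nsmul _ _ ‖B‖ fun i _ => ?_).trans (by simp)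
  refine ((B _).le_opNorm _).trans ?_
  rw [OrthonormalBasis.norm_eq_one, mul_one]
  exact (B.le_opNorm _).trans (by rw [OrthonormalBasis.norm_eq_one, mul_one])

theorem dual_norm_sq_eq_sum (L : E →L[ℝ] ℝ) :
    ‖L‖ ^ 2 = ∑ i, L (stdOrthonormalBasis ℝ E i) ^ 2 := by
  rw [(stdOrthonormalBasis ℝ E).norm_dual]

/-- Gaussian integration by parts for one-forms. -/
theorem integral_form_apply_stdGaussian {V : E → E →L[ℝ] ℝ} {V' : E → E →L[ℝ] E →L[ℝ] ℝ}
    (hV : ∀ x, HasFDerivAt V (V' x) x) (hV' : Continuous V') {M : ℝ} (hM : ∀ x, ‖V x‖ ≤ M)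
    (hM' : ∀ x, ‖V' x‖ ≤ M) (x : E) (s : ℝ) :
    ∫ z, V (x + s • z) z ∂(stdGaussian E)
      = s * ∫ z, bilinTrace (V' (x + s • z)) ∂(stdGaussian E) := by
  have hVc : Continuous V := continuous_iff_continuousAt.2 fun x => (hV x).continuousAt
  have hM0 : 0 ≤ M := (norm_nonneg _).trans (hM 0)
  set e := stdOrthonormalBasis ℝ E with he
  -- Expanding `z` in the basis reduces the claim to scalar Stein identities; the `i`-th one yields
  -- `s` times the `i`-th diagonal entry of the trace.
  have hsum : ∀ z, V (x + s • z) z = ∑ i, V (x + s • z) (e i) * inner ℝ z (e i) := fun z => by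
    conv_lhs => rw [← e.sum_repr' z, map_sum]
    refine Finset.sum_congr rfl fun i _ => ?_
    rw [map_smul, smul_eq_mul, mul_comm, real_inner_comm, e.sum_repr']
  have hterm : ∀ i, ∫ z, V (x + s • z) (e i) * inner ℝ z (e i) ∂(stdGaussian E)
      = ∫ z, s * V' (x + s • z) (e i) (e i) ∂(stdGaussian E) := fun i => by
    have hφ : ∀ z, HasFDerivAt (fun z => V (x + s • z) (e i))
        (((ContinuousLinearMap.apply ℝ ℝ (e i)).comp (V' (x + s • z))).comp
          (s • ContinuousLinearMap.id ℝ E)) z := fun z => by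
      have h1 : HasFDerivAt (fun z : E => x + s • z) (s • ContinuousLinearMap.id ℝ E) z :=
        ((hasFDerivAt_id z).const_smul s).const_add x
      exact (((ContinuousLinearMap.apply ℝ ℝ (e i)).hasFDerivAt).comp _ (hV _)).comp z h1
    have hb : ∀ z, ‖((ContinuousLinearMap.apply ℝ ℝ (e i)).comp (V' (x + s • z))).comp
          (s • ContinuousLinearMap.id ℝ E)‖ ≤ M + |s| * M := fun z => by
      refine ContinuousLinearMap.opNorm_le_bound _ (by positivity) fun w => ?_
      simp only [ContinuousLinearMap.comp_apply, ContinuousLinearMap.apply_apply, FunLike.coe_smul,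
        Pi.smul_apply, ContinuousLinearMap.id_apply]
      rw [map_smul]
      simp only [FunLike.coe_smul, Pi.smul_apply, smul_eq_mul, norm_mul, Real.norm_eq_abs s]
      calc |s| * ‖V' (x + s • z) w (e i)‖ ≤ |s| * (M * ‖w‖ * 1) := by
            gcongr
            rw [← e.norm_eq_one i]
            exact (V' _ w).le_of_opNorm_le ((V' _).le_of_opNorm_le (hM' _) w) _
        _ ≤ _ := by nlinarith [norm_nonneg w, mul_nonneg hM0 (norm_nonneg w)]
    rw [integral_inner_mul_eq_integral_fderiv hφ ?_ (M := M + |s| * M) ?_ hb]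
    · refine integral_congr_ae (Eventually.of_forall fun z => ?_)
      simp
    · fun_prop
    · intro z
      refine ((V _).le_opNorm _).trans ?_
      rw [e.norm_eq_one, mul_one]
      exact (hM _).trans (le_add_of_nonneg_right (by positivity))
  simp_rw [hsum]
  have hint' : ∀ i, Integrable (fun z => V' (x + s • z) (e i) (e i)) (stdGaussian E) := fun i =>
    Integrable.of_bound (Continuous.aestronglyMeasurable (by fun_prop)) M
      (Eventually.of_forall fun z => by
        have := (V' (x + s • z) (e i)).le_of_opNorm_le ((V' _).le_of_opNorm_le (hM' _) (e i)) (e i)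
        simpa using this)
  rw [integral_finsetSum _ fun i _ => ?_]
  · simp only [bilinTrace, hterm, integral_const_mul]
    rw [integral_finsetSum _ fun i _ => hint' i, Finset.mul_sum]
  · refine (integrable_norm_stdGaussian.const_mul M).mono'
      (Continuous.aestronglyMeasurable (by fun_prop)) (Eventually.of_forall fun z => ?_)
    rw [norm_mul]
    gcongr
    · refine ((V _).le_opNorm _).trans ?_
      rw [e.norm_eq_one, mul_one]
      exact hM _
    · refine (norm_inner_le_norm _ _).trans ?_
      rw [e.norm_eq_one, mul_one]

end GaussianCalculus

/-! ### Gaussian averages as the heat semigroup. -/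

section HeatFlow

set_option linter.unusedSectionVars false
set_option maxSynthPendingDepth 3
variable {E : Type*} [NormedAddCommGroup E] [InnerProductSpace ℝ E] [FiniteDimensional ℝ E]
  [MeasurableSpace E] [BorelSpace E]
variable {F : Type*} [NormedAddCommGroup F] [NormedSpace ℝ F]

/-- The average of `g` over a Gaussian of standard deviation `s` centred at `x`. -/
noncomputable def gaussAvg (s : ℝ) (g : E → F) (x : E) : F := ∫ z, g (x + s • z) ∂(stdGaussian E)

/-- Functions with values in `[δ, M]` and two continuous derivatives bounded by `K`. -/
structure BoundedC2 (g : E → ℝ) (g' : E → E →L[ℝ] ℝ) (g'' : E → E →L[ℝ] E →L[ℝ] ℝ)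
    (δ M K : ℝ) : Prop where
  mem_Icc : ∀ x, g x ∈ Set.Icc δ M
  hasFDerivAt : ∀ x, HasFDerivAt g (g' x) x
  hasFDerivAt' : ∀ x, HasFDerivAt g' (g'' x) x
  continuous'' : Continuous g''
  bound' : ∀ x, ‖g' x‖ ≤ K
  bound'' : ∀ x, ‖g'' x‖ ≤ K

theorem BoundedC2.continuous {g : E → ℝ} {g' : E → E →L[ℝ] ℝ} {g'' : E → E →L[ℝ] E →L[ℝ] ℝ}
    {δ M K : ℝ} (h : BoundedC2 g g' g'' δ M K) : Continuous g :=
  continuous_iff_continuousAt.2 fun x => (h.hasFDerivAt x).continuousAt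

theorem BoundedC2.continuous' {g : E → ℝ} {g' : E → E →L[ℝ] ℝ} {g'' : E → E →L[ℝ] E →L[ℝ] ℝ}
    {δ M K : ℝ} (h : BoundedC2 g g' g'' δ M K) : Continuous g' :=
  continuous_iff_continuousAt.2 fun x => (h.hasFDerivAt' x).continuousAt

theorem BoundedC2.norm_le {g : E → ℝ} {g' : E → E →L[ℝ] ℝ} {g'' : E → E →L[ℝ] E →L[ℝ] ℝ}
    {δ M K : ℝ} (h : BoundedC2 g g' g'' δ M K) (x : E) : ‖g x‖ ≤ max |δ| |M| := by
  rw [Real.norm_eq_abs]; exact abs_le_max_abs_abs (h.mem_Icc x).1 (h.mem_Icc x).2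

theorem integrable_comp_translate {g : E → F} (hg : Continuous g) {C : ℝ} (hC : ∀ x, ‖g x‖ ≤ C)
    (s : ℝ) (x : E) : Integrable (fun z => g (x + s • z)) (stdGaussian E) :=
  Integrable.of_bound (Continuous.aestronglyMeasurable (by fun_prop)) C
    (Eventually.of_forall fun _ => hC _)

theorem continuous_gaussAvg {g : E → F} (hg : Continuous g) {C : ℝ} (hC : ∀ x, ‖g x‖ ≤ C) :
    Continuous fun p : ℝ × E => gaussAvg p.1 g p.2 :=
  continuous_of_dominated (fun _ => Continuous.aestronglyMeasurable (by fun_prop))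
    (fun _ => Eventually.of_forall fun _ => hC _) (integrable_const C)
    (Eventually.of_forall fun _ => by fun_prop)

theorem continuous_gaussAvg_right {g : E → F} (hg : Continuous g) {C : ℝ} (hC : ∀ x, ‖g x‖ ≤ C)
    (s : ℝ) : Continuous (gaussAvg s g) :=
  (continuous_gaussAvg hg hC).comp (g := fun p : ℝ × E => gaussAvg p.1 g p.2)
    (f := fun x => (s, x)) (Continuous.prodMk_right s)

theorem norm_gaussAvg_le {g : E → F} {C : ℝ} (hC : ∀ x, ‖g x‖ ≤ C) (s : ℝ) (x : E) :
    ‖gaussAvg s g x‖ ≤ C := by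
  have := norm_integral_le_of_norm_le_const (μ := stdGaussian E)
    (Eventually.of_forall fun z => hC (x + s • z))
  rwa [probReal_univ, mul_one] at this

theorem gaussAvg_mem_Icc {g : E → ℝ} (hg : Continuous g) {δ M : ℝ} (h : ∀ x, g x ∈ Set.Icc δ M)
    (s : ℝ) (x : E) : gaussAvg s g x ∈ Set.Icc δ M := by
  have hi := integrable_comp_translate hg (C := max |δ| |M|)
    (fun x => abs_le_max_abs_abs (h x).1 (h x).2) s x
  constructor
  · simpa using! integral_mono (integrable_const δ) hi fun z => (h (x + s • z)).1
  · simpa using! integral_mono hi (integrable_const M) fun z => (h (x + s • z)).2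

theorem hasFDerivAt_gaussAvg {g : E → F} {g' : E → E →L[ℝ] F} (hg : ∀ x, HasFDerivAt g (g' x) x)
    (hg' : Continuous g') {C M : ℝ} (hC : ∀ x, ‖g x‖ ≤ C) (hM : ∀ x, ‖g' x‖ ≤ M) (s : ℝ) (x : E) :
    HasFDerivAt (gaussAvg s g) (gaussAvg s g' x) x :=
  hasFDerivAt_integral_translate (stdGaussian E) (measurable_const_smul s) hg hg' hC hM x

theorem BoundedC2.gaussAvg {g : E → ℝ} {g' : E → E →L[ℝ] ℝ} {g'' : E → E →L[ℝ] E →L[ℝ] ℝ}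
    {δ M K : ℝ} (h : BoundedC2 g g' g'' δ M K) (s : ℝ) :
    BoundedC2 (gaussAvg s g) (gaussAvg s g') (gaussAvg s g'') δ M K where
  mem_Icc := gaussAvg_mem_Icc h.continuous h.mem_Icc s
  hasFDerivAt := hasFDerivAt_gaussAvg h.hasFDerivAt h.continuous' h.norm_le h.bound' s
  hasFDerivAt' := hasFDerivAt_gaussAvg h.hasFDerivAt' h.continuous'' h.bound' h.bound'' s
  continuous'' := continuous_gaussAvg_right h.continuous'' h.bound'' s
  bound' := norm_gaussAvg_le h.bound' s
  bound'' := norm_gaussAvg_le h.bound'' s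

/-- Semigroup property. -/
theorem gaussAvg_gaussAvg [CompleteSpace F] {g : E → F} (hg : Continuous g) {C : ℝ}
    (hC : ∀ x, ‖g x‖ ≤ C) {a b c : ℝ} (h : a ^ 2 + b ^ 2 = c ^ 2) (x : E) :
    gaussAvg a (gaussAvg b g) x = gaussAvg c g x := by
  have hint : Integrable (fun p : E × E => g (x + a • p.1 + b • p.2))
      ((stdGaussian E).prod (stdGaussian E)) :=
    Integrable.of_bound (Continuous.aestronglyMeasurable (by fun_prop)) C
      (Eventually.of_forall fun _ => hC _)
  have h1 : gaussAvg a (gaussAvg b g) x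
      = ∫ p, g (x + a • p.1 + b • p.2) ∂((stdGaussian E).prod (stdGaussian E)) :=
    (integral_prod _ hint).symm
  have h2 : ∫ y, g (x + y) ∂(((stdGaussian E).prod (stdGaussian E)).map
      (fun p => a • p.1 + b • p.2)) = ∫ y, g (x + y) ∂((stdGaussian E).map (fun z => c • z)) := by
    rw [stdGaussian_prod_map_smul_add_smul h]
  rw [integral_map (by fun_prop) (Continuous.aestronglyMeasurable (by fun_prop)),
    integral_map (by fun_prop) (Continuous.aestronglyMeasurable (by fun_prop))] at h2
  simp only [h1, add_assoc, h2]
  rfl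

/-- The point of the linear parameter is the choice `H = E × ℝ`, `A z (y, b) = y + b • z`, which
differentiates a Gaussian average in centre and scale at once. Here `‖A z‖` is unbounded, hence the
integrable majorant `B`. -/
theorem hasFDerivAt_integral_comp_clm {H Ω : Type*} [NormedAddCommGroup H] [NormedSpace ℝ H]
    [MeasurableSpace Ω] [TopologicalSpace Ω] [BorelSpace Ω] [SecondCountableTopology Ω]
    (P : Measure Ω) [IsFiniteMeasure P] {g : E → ℝ} {g' : E → E →L[ℝ] ℝ}
    (hg : ∀ x, HasFDerivAt g (g' x) x) (hg' : Continuous g') {C K : ℝ} (hC : ∀ x, ‖g x‖ ≤ C)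
    (hK : ∀ x, ‖g' x‖ ≤ K) {A : Ω → H →L[ℝ] E} (hA : Continuous A) {B : Ω → ℝ}
    (hB : Integrable B P) (hAB : ∀ ω, ‖A ω‖ ≤ B ω) (p : H)
    {D : H →L[ℝ] ℝ} (hD : ∀ v, D v = ∫ ω, g' (A ω p) (A ω v) ∂P) :
    HasFDerivAt (fun p => ∫ ω, g (A ω p) ∂P) D p := by
  have hgc : Continuous g := continuous_iff_continuousAt.2 fun x => (hg x).continuousAt
  have hbound : ∀ p ω, ‖(g' (A ω p)).comp (A ω)‖ ≤ K * B ω := fun p ω =>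
    (ContinuousLinearMap.opNorm_comp_le _ _).trans (mul_le_mul (hK _) (hAB ω) (norm_nonneg _)
      ((norm_nonneg _).trans (hK 0)))
  have hm : ∀ p, AEStronglyMeasurable (fun ω => (g' (A ω p)).comp (A ω)) P := fun p =>
    Continuous.aestronglyMeasurable (by fun_prop)
  have hi : Integrable (fun ω => K * B ω) P := hB.const_mul K
  have key := hasFDerivAt_integral_of_dominated_of_fderiv_le (μ := P)
    (F := fun (p : H) ω => g (A ω p))
    (F' := fun (p : H) ω => (g' (A ω p)).comp (A ω)) (x₀ := p)
    (bound := fun ω => K * B ω) Filter.univ_mem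
    (Eventually.of_forall fun p => Continuous.aestronglyMeasurable (by fun_prop))
    (Integrable.of_bound (Continuous.aestronglyMeasurable (by fun_prop)) C
      (Eventually.of_forall fun ω => hC _))
    (hm p) (Eventually.of_forall fun ω p _ => hbound p ω) hi
    (Eventually.of_forall fun ω p _ => (hg _).comp p (A ω).hasFDerivAt)
  refine key.congr_fderiv (ContinuousLinearMap.ext fun v => ?_)
  rw [ContinuousLinearMap.integral_apply
    (hi.mono' (hm p) (Eventually.of_forall fun ω => hbound p ω)), hD]
  rfl

/-- The derivative in the scale is the average of `g'(y + b z) z`, which Stein's identity turns into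
`b` times the averaged Laplacian. This is the heat equation, in a form that does not degenerate at
`b = 0`. -/
theorem hasFDerivAt_gaussAvg_prod {g : E → ℝ} {g' : E → E →L[ℝ] ℝ}
    {g'' : E → E →L[ℝ] E →L[ℝ] ℝ} {δ M K : ℝ} (h : BoundedC2 g g' g'' δ M K) (y : E) (b : ℝ) :
    HasFDerivAt (fun p : E × ℝ => gaussAvg p.2 g p.1)
      ((gaussAvg b g' y).comp (ContinuousLinearMap.fst ℝ E ℝ)
        + (b * bilinTrace (gaussAvg b g'' y)) • ContinuousLinearMap.snd ℝ E ℝ) (y, b) := by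
  have hg' := h.continuous'
  have hg'' := h.continuous''
  let A : E → E × ℝ →L[ℝ] E := fun z =>
    ContinuousLinearMap.fst ℝ E ℝ + (ContinuousLinearMap.snd ℝ E ℝ).smulRight z
  have hA : A = fun z => ContinuousLinearMap.fst ℝ E ℝ
      + ContinuousLinearMap.smulRightL ℝ (E × ℝ) E (ContinuousLinearMap.snd ℝ E ℝ) z := rfl
  have hAn : ∀ z, ‖A z‖ ≤ 1 + ‖z‖ := fun z => by
    refine ContinuousLinearMap.opNorm_le_bound _ (by positivity) fun p => ?_
    have : A z p = p.1 + p.2 • z := rfl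
    rw [this]
    refine (norm_add_le _ _).trans ?_
    rw [norm_smul]
    nlinarith [norm_fst_le p, mul_le_mul_of_nonneg_right (norm_snd_le p) (norm_nonneg z)]
  refine hasFDerivAt_integral_comp_clm (stdGaussian E) h.hasFDerivAt hg' h.norm_le h.bound'
    (A := A) (by rw [hA]; fun_prop)
    ((integrable_const 1).add integrable_norm_stdGaussian) hAn (y, b) fun p => ?_
  have hint' := integrable_comp_translate hg' h.bound' b y
  have hint'' := integrable_comp_translate (F := E →L[ℝ] E →L[ℝ] ℝ) hg'' h.bound'' b y
  have hix : Integrable (fun z => g' (y + b • z) z) (stdGaussian E) :=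
    (integrable_norm_stdGaussian.const_mul K).mono'
      (Continuous.aestronglyMeasurable (by fun_prop))
      (Eventually.of_forall fun z => (g' _).le_of_opNorm_le (h.bound' _) z)
  have e1 : ∀ z, g' (A z (y, b)) (A z p)
      = g' (y + b • z) p.1 + p.2 * g' (y + b • z) z := fun z => by
    have : ∀ p, A z p = p.1 + p.2 • z := fun p => rfl
    rw [this, this, map_add, map_smul, smul_eq_mul]
  have e2 : bilinTrace (gaussAvg b g'' y) = ∫ z, bilinTrace (g'' (y + b • z)) ∂stdGaussian E := by
    simp only [bilinTrace, gaussAvg]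
    have hii : ∀ v, Integrable (fun z => g'' (y + b • z) v) (stdGaussian E) := fun v =>
      hint''.apply_continuousLinearMap v
    rw [integral_finsetSum _ fun i _ => (hii _).apply_continuousLinearMap _]
    refine Finset.sum_congr rfl fun i _ => ?_
    rw [ContinuousLinearMap.integral_apply hint'', ContinuousLinearMap.integral_apply (hii _)]
  simp only [e1]
  rw [integral_add (hint'.apply_continuousLinearMap _) (hix.const_mul _), integral_const_mul,
    integral_form_apply_stdGaussian h.hasFDerivAt' hg'' h.bound' h.bound'', ← e2,
    ← ContinuousLinearMap.integral_apply hint']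
  simp [gaussAvg]
  ring

/-- Derivative of a heat flow along a Brownian-scaling path. -/
theorem hasDerivAt_gaussAvg_path {g : E → ℝ} {g' : E → E →L[ℝ] ℝ}
    {g'' : E → E →L[ℝ] E →L[ℝ] ℝ} {δ M K : ℝ} (h : BoundedC2 g g' g'' δ M K)
    {a b : ℝ → ℝ} {a' b' t : ℝ} (ha : HasDerivAt a a' t) (hb : HasDerivAt b b' t)
    (hbb : b t * b' = -1) (x z : E) :
    HasDerivAt (fun s => gaussAvg (b s) g (x + a s • z))
      (gaussAvg (b t) g' (x + a t • z) (a' • z)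
        - bilinTrace (gaussAvg (b t) g'' (x + a t • z))) t := by
  have h1 : HasDerivAt (fun s => (x + a s • z, b s)) (a' • z, b') t :=
    ((ha.smul_const z).const_add x).prodMk hb
  have h2 := (hasFDerivAt_gaussAvg_prod h (x + a t • z) (b t)).comp_hasDerivAt t h1
  refine h2.congr_deriv ?_
  simp only [add_apply, ContinuousLinearMap.comp_apply, ContinuousLinearMap.coe_fst',
    smul_apply, ContinuousLinearMap.coe_snd', smul_eq_mul]
  -- The condition `b b' = -1` means that the variance `b²` falls at rate `2`, so the Laplacian
  -- enters with coefficient `-1`.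
  linear_combination bilinTrace (gaussAvg (b t) g'' (x + a t • z)) * hbb
end HeatFlow

/-! ### Differentiating functionals along the backward heat flow. -/

section Interpolation

set_option linter.unusedSectionVars false
set_option maxSynthPendingDepth 3
variable {E : Type*} [NormedAddCommGroup E] [InnerProductSpace ℝ E] [FiniteDimensional ℝ E]
  [MeasurableSpace E] [BorelSpace E]

/-- A time-dependent function `Ψ t u` with its partial derivatives, regular for `t ∈ [0, T]` and
`u ∈ [δ, M]`. -/
structure FlowIntegrand (Ψ Ψ₁ Ψ₂ Ψt : ℝ → ℝ → ℝ) (T δ M : ℝ) : Prop where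
  cont : ContinuousOn (Function.uncurry Ψ) (Set.Icc 0 T ×ˢ Set.Icc δ M)
  cont₁ : ContinuousOn (Function.uncurry Ψ₁) (Set.Icc 0 T ×ˢ Set.Icc δ M)
  cont₂ : ContinuousOn (Function.uncurry Ψ₂) (Set.Icc 0 T ×ˢ Set.Icc δ M)
  contt : ContinuousOn (Function.uncurry Ψt) (Set.Icc 0 T ×ˢ Set.Icc δ M)
  hasDerivAt_path : ∀ t ∈ Set.Ioo 0 T, ∀ (v : ℝ → ℝ) (v' : ℝ), HasDerivAt v v' t →
    v t ∈ Set.Icc δ M → HasDerivAt (fun s => Ψ s (v s)) (Ψt t (v t) + Ψ₁ t (v t) * v') t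
  hasDerivAt₁ : ∀ t ∈ Set.Ioo 0 T, ∀ u ∈ Set.Icc δ M, HasDerivAt (Ψ₁ t) (Ψ₂ t u) u

/-- The heat flow of `g` run backwards from time `T`, at the point reached from `p.1` at time `t`
with Gaussian increment `p.2`. -/
noncomputable def flowValue (T : ℝ) (g : E → ℝ) (t : ℝ) (p : E × E) : ℝ :=
  gaussAvg √(2 * (T - t)) g (p.1 + √(2 * t) • p.2)

theorem continuousOn_slice {Φ : ℝ → ℝ → ℝ} {T δ M : ℝ}
    (h : ContinuousOn (Function.uncurry Φ) (Set.Icc 0 T ×ˢ Set.Icc δ M)) {t : ℝ}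
    (ht : t ∈ Set.Icc 0 T) {X : Type*} [TopologicalSpace X] {u : X → ℝ} (hu : Continuous u)
    (hu' : ∀ x, u x ∈ Set.Icc δ M) : Continuous fun x => Φ t (u x) :=
  h.comp_continuous (f := fun x => (t, u x)) (by fun_prop) fun x => ⟨ht, hu' x⟩

theorem exists_bound_slice {Φ : ℝ → ℝ → ℝ} {T δ M : ℝ}
    (h : ContinuousOn (Function.uncurry Φ) (Set.Icc 0 T ×ˢ Set.Icc δ M)) :
    ∃ C, 0 ≤ C ∧ ∀ t ∈ Set.Icc 0 T, ∀ u ∈ Set.Icc δ M, ‖Φ t u‖ ≤ C := by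
  obtain ⟨C, hC⟩ := (isCompact_Icc.prod isCompact_Icc).exists_bound_of_continuousOn h
  exact ⟨max C 0, le_max_right _ _, fun t ht u hu => (hC (t, u) ⟨ht, hu⟩).trans (le_max_left _ _)⟩

variable {g : E → ℝ} {g' : E → E →L[ℝ] ℝ} {g'' : E → E →L[ℝ] E →L[ℝ] ℝ} {δ M K T : ℝ}
  {Ψ Ψ₁ Ψ₂ Ψt : ℝ → ℝ → ℝ}

theorem flowValue_mem (h : BoundedC2 g g' g'' δ M K) (t : ℝ) (p : E × E) :
    flowValue T g t p ∈ Set.Icc δ M := gaussAvg_mem_Icc h.continuous h.mem_Icc _ _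

theorem continuous_flowValue (h : BoundedC2 g g' g'' δ M K) :
    Continuous fun q : ℝ × (E × E) => flowValue T g q.1 q.2 :=
  (continuous_gaussAvg h.continuous h.norm_le).comp
    (g := fun q : ℝ × E => gaussAvg q.1 g q.2)
    (f := fun q : ℝ × (E × E) => (√(2 * (T - q.1)), q.2.1 + √(2 * q.1) • q.2.2)) (by fun_prop)

theorem continuousOn_integral_flow (κ : Measure E) [IsProbabilityMeasure κ]
    (h : BoundedC2 g g' g'' δ M K) (hΨ : ContinuousOn (Function.uncurry Ψ)
      (Set.Icc 0 T ×ˢ Set.Icc δ M)) :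
    ContinuousOn (fun t => ∫ p, Ψ t (flowValue T g t p) ∂(κ.prod (stdGaussian E)))
      (Set.Icc 0 T) := by
  obtain ⟨C, -, hC⟩ := exists_bound_slice hΨ
  have hf := continuous_flowValue (T := T) h
  refine continuousOn_of_dominated (bound := fun _ => C) (fun t ht => ?_) (fun t ht => ?_)
    (integrable_const _) (Eventually.of_forall fun p => ?_)
  · exact (continuousOn_slice hΨ ht (hf.comp (Continuous.prodMk_right t))
      (flowValue_mem h t)).aestronglyMeasurable
  · exact Eventually.of_forall fun p => hC t ht _ (flowValue_mem h t p)
  · exact hΨ.comp (f := fun t => (t, flowValue T g t p))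
      (continuous_id.prodMk (hf.comp (Continuous.prodMk_left p))).continuousOn
      fun t ht => ⟨ht, flowValue_mem h t p⟩

/-- The one-form `φ(g) dg` and its derivative. -/
theorem BoundedC2.exists_hasFDerivAt_smul (h : BoundedC2 g g' g'' δ M K)
    {φ φ' : ℝ → ℝ} (hφ : ∀ u ∈ Set.Icc δ M, HasDerivAt φ (φ' u) u)
    (hφ' : ContinuousOn φ' (Set.Icc δ M)) :
    ∃ (V' : E → E →L[ℝ] E →L[ℝ] ℝ) (C : ℝ),
      (∀ y, HasFDerivAt (fun y => φ (g y) • g' y) (V' y) y) ∧ Continuous V' ∧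
      (∀ y, ‖φ (g y) • g' y‖ ≤ C) ∧ (∀ y, ‖V' y‖ ≤ C) ∧
      ∀ y, bilinTrace (V' y) = φ (g y) * bilinTrace (g'' y) + φ' (g y) * ‖g' y‖ ^ 2 := by
  have hφc : ContinuousOn φ (Set.Icc δ M) := fun u hu => (hφ u hu).continuousAt.continuousWithinAt
  obtain ⟨C₁, hC₁⟩ := isCompact_Icc.exists_bound_of_continuousOn hφc
  obtain ⟨C₂, hC₂⟩ := isCompact_Icc.exists_bound_of_continuousOn hφ'
  have hg := h.continuous
  have hg' := h.continuous'
  have hg'' := h.continuous''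
  have c1 : Continuous fun y => φ (g y) := hφc.comp_continuous hg h.mem_Icc
  have c2 : Continuous fun y => φ' (g y) := hφ'.comp_continuous hg h.mem_Icc
  have hK : 0 ≤ K := (norm_nonneg _).trans (h.bound' 0)
  have hC₁0 : 0 ≤ C₁ := (norm_nonneg _).trans (hC₁ _ (h.mem_Icc 0))
  have hC₂0 : 0 ≤ C₂ := (norm_nonneg _).trans (hC₂ _ (h.mem_Icc 0))
  let V : E → E →L[ℝ] ℝ := fun y => φ (g y) • g' y
  let V' : E → E →L[ℝ] E →L[ℝ] ℝ := fun y =>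
    φ (g y) • g'' y + ContinuousLinearMap.smulRightL ℝ E (E →L[ℝ] ℝ) (φ' (g y) • g' y) (g' y)
  have hV : ∀ y, HasFDerivAt V (V' y) y := fun y =>
    ((hφ _ (h.mem_Icc y)).comp_hasFDerivAt y (h.hasFDerivAt y)).smul (h.hasFDerivAt' y)
  have hV'c : Continuous V' := by
    have h2 : Continuous fun y => φ' (g y) • g' y := c2.smul hg'
    have h3 : Continuous fun y => φ (g y) • g'' y := c1.smul hg''
    have h4 : Continuous fun y =>
      ContinuousLinearMap.smulRightL ℝ E (E →L[ℝ] ℝ) (φ' (g y) • g' y) (g' y) := by fun_prop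
    exact Continuous.add (M := E →L[ℝ] (E →L[ℝ] ℝ)) h3 h4
  have hVb : ∀ y, ‖V y‖ ≤ C₁ * K + C₂ * K * K := fun y => by
    rw [norm_smul]
    have := mul_le_mul (hC₁ _ (h.mem_Icc y)) (h.bound' y) (norm_nonneg _) hC₁0
    have : 0 ≤ C₂ * K * K := by positivity
    linarith
  have hV'b : ∀ y, ‖V' y‖ ≤ C₁ * K + C₂ * K * K := fun y => by
    refine (norm_add_le (E := E →L[ℝ] (E →L[ℝ] ℝ)) _ _).trans (add_le_add ?_ ?_)
    · rw [norm_smul]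
      exact mul_le_mul (hC₁ _ (h.mem_Icc y)) (h.bound'' y) (norm_nonneg _) hC₁0
    · have : ContinuousLinearMap.smulRightL ℝ E (E →L[ℝ] ℝ) (φ' (g y) • g' y) (g' y)
          = (φ' (g y) • g' y).smulRight (g' y) := rfl
      rw [this, ContinuousLinearMap.norm_smulRight_apply, norm_smul]
      gcongr
      exacts [hC₂ _ (h.mem_Icc y), h.bound' y, h.bound' y]
  have htr : ∀ y, bilinTrace (V' y) = φ (g y) * bilinTrace (g'' y) + φ' (g y) * ‖g' y‖ ^ 2 :=
    fun y => by
    rw [dual_norm_sq_eq_sum]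
    simp only [bilinTrace, V', Finset.mul_sum, ← Finset.sum_add_distrib]
    refine Finset.sum_congr rfl fun i _ => ?_
    have : ContinuousLinearMap.smulRightL ℝ E (E →L[ℝ] ℝ) (φ' (g y) • g' y) (g' y)
          = (φ' (g y) • g' y).smulRight (g' y) := rfl
    rw [this]
    simp only [add_apply, smul_apply, ContinuousLinearMap.smulRight_apply, smul_eq_mul]
    ring
  exact ⟨V', _, hV, hV'c, hVb, hV'b, htr⟩

/-- Composition with a function that is `C²` on the range. -/
theorem BoundedC2.exists_comp (h : BoundedC2 g g' g'' δ M K)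
    {ψ φ φ' : ℝ → ℝ} (hψ : ∀ u ∈ Set.Icc δ M, HasDerivAt ψ (φ u) u)
    (hφ : ∀ u ∈ Set.Icc δ M, HasDerivAt φ (φ' u) u)
    (hφ' : ContinuousOn φ' (Set.Icc δ M)) {δ' M' : ℝ}
    (hm : Set.MapsTo ψ (Set.Icc δ M) (Set.Icc δ' M')) :
    ∃ (V' : E → E →L[ℝ] E →L[ℝ] ℝ) (C : ℝ),
      BoundedC2 (fun y => ψ (g y)) (fun y => φ (g y) • g' y) V' δ' M' C := by
  obtain ⟨V', C, h1, h2, h3, h4, -⟩ := h.exists_hasFDerivAt_smul hφ hφ'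
  exact ⟨V', C, fun x => hm (h.mem_Icc x),
    fun x => (hψ _ (h.mem_Icc x)).comp_hasFDerivAt x (h.hasFDerivAt x), h1, h2, h3, h4⟩

/-- The one-form `φ(g) dg` has divergence `φ(g) Δg + φ'(g) ‖dg‖²`. Stein's identity turns its
pairing with `z / a` into the average of this divergence, whose first term cancels the subtracted
Laplacian. -/
theorem integral_flow_by_parts (h : BoundedC2 g g' g'' δ M K)
    {φ φ' : ℝ → ℝ} (hφ : ∀ u ∈ Set.Icc δ M, HasDerivAt φ (φ' u) u)
    (hφ' : ContinuousOn φ' (Set.Icc δ M)) (x : E) {a : ℝ} (ha : 0 < a) :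
    ∫ z, φ (g (x + a • z)) * (g' (x + a • z) (a⁻¹ • z) - bilinTrace (g'' (x + a • z)))
        ∂(stdGaussian E)
      = ∫ z, φ' (g (x + a • z)) * ‖g' (x + a • z)‖ ^ 2 ∂(stdGaussian E) := by
  have hφc : ContinuousOn φ (Set.Icc δ M) := fun u hu => (hφ u hu).continuousAt.continuousWithinAt
  obtain ⟨C₁, hC₁⟩ := isCompact_Icc.exists_bound_of_continuousOn hφc
  obtain ⟨C₂, hC₂⟩ := isCompact_Icc.exists_bound_of_continuousOn hφ'
  have hg := h.continuous
  have hg' := h.continuous'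
  have hg'' := h.continuous''
  have c1 : Continuous fun y => φ (g y) := hφc.comp_continuous hg h.mem_Icc
  have c2 : Continuous fun y => φ' (g y) := hφ'.comp_continuous hg h.mem_Icc
  have hC₁0 : 0 ≤ C₁ := (norm_nonneg _).trans (hC₁ _ (h.mem_Icc 0))
  have hC₂0 : 0 ≤ C₂ := (norm_nonneg _).trans (hC₂ _ (h.mem_Icc 0))
  obtain ⟨V', CV, hV, hV'c, hVb, hV'b, htr⟩ := h.exists_hasFDerivAt_smul hφ hφ'
  have key := integral_form_apply_stdGaussian hV hV'c hVb hV'b x a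
  simp only [htr] at key
  have bt : Continuous fun y => bilinTrace (g'' y) := continuous_bilinTrace.comp hg''
  have i1 : Integrable (fun z => φ (g (x + a • z)) * bilinTrace (g'' (x + a • z)))
      (stdGaussian E) :=
    integrable_comp_translate (g := fun y => φ (g y) * bilinTrace (g'' y)) (c1.mul bt)
      (C := C₁ * (Module.finrank ℝ E * K)) (fun y => by
        rw [norm_mul]
        exact mul_le_mul (hC₁ _ (h.mem_Icc y)) ((norm_bilinTrace_le _).trans (by
          gcongr; exact h.bound'' y)) (norm_nonneg _) hC₁0) a x
  have i2 : Integrable (fun z => φ' (g (x + a • z)) * ‖g' (x + a • z)‖ ^ 2) (stdGaussian E) :=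
    integrable_comp_translate (g := fun y => φ' (g y) * ‖g' y‖ ^ 2) (c2.mul (by fun_prop))
      (C := C₂ * K ^ 2) (fun y => by
        rw [norm_mul, norm_pow, norm_norm]
        gcongr
        exacts [hC₂ _ (h.mem_Icc y), h.bound' y]) a x
  have i3 : Integrable (fun z => (φ (g (x + a • z)) • g' (x + a • z)) z) (stdGaussian E) := by
    have hVc : Continuous fun y => φ (g y) • g' y :=
      continuous_iff_continuousAt.2 fun x => (hV x).continuousAt
    exact (integrable_norm_stdGaussian.const_mul _).mono'
      ((hVc.comp (by fun_prop)).clm_apply continuous_id).aestronglyMeasurable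
      (Eventually.of_forall fun z => ContinuousLinearMap.le_of_opNorm_le _ (hVb _) z)
  rw [integral_add i1 i2] at key
  have e : ∀ z, φ (g (x + a • z)) * (g' (x + a • z) (a⁻¹ • z) - bilinTrace (g'' (x + a • z)))
      = a⁻¹ * (φ (g (x + a • z)) • g' (x + a • z)) z - φ (g (x + a • z)) * bilinTrace (g'' (x + a • z)) := fun z => by
    simp only [map_smul, smul_apply, smul_eq_mul]
    ring
  simp only [e]
  rw [integral_sub (i3.const_mul _) i1, integral_const_mul, key]
  field_simp
  ring

/-- At `x + √(2t) z` the backward flow changes at rate `du(z / √(2t)) - Δu`. After weighting by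
`Ψ₁(u)` and integrating by parts in `z`, the Laplacians cancel and `Ψ₂(u) ‖du‖²` is left. Both the
entropy and the hypercontractivity estimate are instances of this formula. -/
theorem hasDerivAt_integral_flow (κ : Measure E) [IsProbabilityMeasure κ]
    (h : BoundedC2 g g' g'' δ M K) (hΨ : FlowIntegrand Ψ Ψ₁ Ψ₂ Ψt T δ M) {t : ℝ}
    (ht : t ∈ Set.Ioo 0 T) :
    HasDerivAt (fun t => ∫ p, Ψ t (flowValue T g t p) ∂(κ.prod (stdGaussian E)))
      (∫ p, (Ψt t (flowValue T g t p) + Ψ₂ t (flowValue T g t p)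
          * ‖gaussAvg √(2 * (T - t)) g' (p.1 + √(2 * t) • p.2)‖ ^ 2) ∂(κ.prod (stdGaussian E)))
      t := by
  have htc : t ∈ Set.Icc 0 T := ⟨ht.1.le, ht.2.le⟩
  have hK : 0 ≤ K := (norm_nonneg _).trans (h.bound' 0)
  obtain ⟨C, hC0, hC⟩ := exists_bound_slice hΨ.cont
  obtain ⟨C₁, hC₁0, hC₁⟩ := exists_bound_slice hΨ.cont₁
  obtain ⟨C₂, hC₂0, hC₂⟩ := exists_bound_slice hΨ.cont₂
  obtain ⟨Ct, hCt0, hCt⟩ := exists_bound_slice hΨ.contt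
  have hf := continuous_flowValue (T := T) h
  have hft : ∀ t, Continuous (flowValue T g t) := fun t => hf.comp (Continuous.prodMk_right t)
  let y : ℝ → E × E → E := fun s p => p.1 + √(2 * s) • p.2
  have hy : ∀ s, Continuous (y s) := fun s => by fun_prop
  let U' : ℝ → E × E → ℝ := fun s p =>
    gaussAvg √(2 * (T - s)) g' (y s p) ((√(2 * s))⁻¹ • p.2)
      - bilinTrace (gaussAvg √(2 * (T - s)) g'' (y s p))
  have hU' : ∀ s ∈ Set.Ioo 0 T, ∀ p, HasDerivAt (fun s => flowValue T g s p) (U' s p) s :=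
    fun s hs p => by
    have h1 : 0 < 2 * s := by linarith [hs.1]
    have h2 : 0 < 2 * (T - s) := by linarith [hs.2]
    have ha : HasDerivAt (fun s => √(2 * s)) (√(2 * s))⁻¹ s := by
      have := ((hasDerivAt_id s).const_mul 2).sqrt h1.ne'
      refine this.congr_deriv ?_
      simp only [id]; field_simp
    have hb : HasDerivAt (fun s => √(2 * (T - s))) (-(√(2 * (T - s)))⁻¹) s := by
      have := (((hasDerivAt_id s).const_sub T).const_mul 2).sqrt h2.ne'
      refine this.congr_deriv ?_
      simp only [id]; field_simp
    refine hasDerivAt_gaussAvg_path h ha hb ?_ p.1 p.2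
    have := (Real.sqrt_pos.2 h2).ne'
    field_simp
  have hU'c : ∀ s, Continuous (U' s) := fun s => by
    have c1 := ((h.gaussAvg √(2 * (T - s))).continuous').comp (hy s)
    have c2 := ((h.gaussAvg √(2 * (T - s))).continuous'').comp (hy s)
    exact (c1.clm_apply (by fun_prop)).sub (continuous_bilinTrace.comp c2)
  -- Staying above `t / 2` keeps the singular factor `1 / √(2s)` below `1 / √t`, which provides the
  -- dominating function.
  have hU'b : ∀ s ∈ Set.Ioo (t / 2) T, ∀ p, ‖U' s p‖
      ≤ K * ((√t)⁻¹ * ‖p.2‖) + Module.finrank ℝ E * K := fun s hs p => by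
    refine (norm_sub_le _ _).trans (add_le_add ?_ ?_)
    · refine ((gaussAvg √(2 * (T - s)) g' (y s p)).le_of_opNorm_le
        ((h.gaussAvg _).bound' _) _).trans ?_
      rw [norm_smul, norm_inv, Real.norm_of_nonneg (Real.sqrt_nonneg _)]
      have := Real.sqrt_pos.2 ht.1
      gcongr
      linarith [hs.1]
    · exact (norm_bilinTrace_le _).trans (by gcongr; exact (h.gaussAvg _).bound'' _)
  let G' : ℝ → E × E → ℝ := fun s p =>
    Ψt s (flowValue T g s p) + Ψ₁ s (flowValue T g s p) * U' s p
  have ct : Continuous fun p => Ψt t (flowValue T g t p) :=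
    continuousOn_slice hΨ.contt htc (hft t) (flowValue_mem h t)
  have c1 : Continuous fun p => Ψ₁ t (flowValue T g t p) :=
    continuousOn_slice hΨ.cont₁ htc (hft t) (flowValue_mem h t)
  have c2 : Continuous fun p => Ψ₂ t (flowValue T g t p) :=
    continuousOn_slice hΨ.cont₂ htc (hft t) (flowValue_mem h t)
  have hG'c : Continuous (G' t) := ct.add (c1.mul (hU'c t))
  have hn : Integrable (fun p : E × E => ‖p.2‖) (κ.prod (stdGaussian E)) :=
    integrable_norm_stdGaussian.comp_snd κ
  have hbi : Integrable (fun p : E × E => C₁ * (K * ((√t)⁻¹ * ‖p.2‖) + Module.finrank ℝ E * K))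
      (κ.prod (stdGaussian E)) :=
    (((hn.const_mul _).const_mul _).add (integrable_const _)).const_mul _
  have hs : Set.Ioo (t / 2) T ∈ 𝓝 t := Ioo_mem_nhds (by linarith [ht.1]) ht.2
  have key := hasDerivAt_integral_of_dominated_loc_of_deriv_le (μ := κ.prod (stdGaussian E))
    (F := fun s p => Ψ s (flowValue T g s p)) (F' := G') (x₀ := t) (𝕜 := ℝ)
    (bound := fun p => Ct + C₁ * (K * ((√t)⁻¹ * ‖p.2‖) + Module.finrank ℝ E * K)) hs
    (by
      filter_upwards [hs] with s hs
      exact (continuousOn_slice hΨ.cont ⟨by linarith [hs.1, ht.1], hs.2.le⟩ (hft s)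
        (flowValue_mem h s)).aestronglyMeasurable)
    (Integrable.of_bound (continuousOn_slice hΨ.cont htc (hft t)
        (flowValue_mem h t)).aestronglyMeasurable C
        (Eventually.of_forall fun p => hC t htc _ (flowValue_mem h t p)))
    hG'c.aestronglyMeasurable
    (Eventually.of_forall fun p s hs => by
      have hsc : s ∈ Set.Icc 0 T := ⟨by linarith [hs.1, ht.1], hs.2.le⟩
      refine (norm_add_le _ _).trans (add_le_add (hCt s hsc _ (flowValue_mem h s p)) ?_)
      rw [norm_mul]
      exact mul_le_mul (hC₁ s hsc _ (flowValue_mem h s p)) (hU'b s hs p) (norm_nonneg _) hC₁0)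
    ((integrable_const _).add hbi)
    (Eventually.of_forall fun p s hs => by
      have hso : s ∈ Set.Ioo 0 T := ⟨by linarith [hs.1, ht.1], hs.2⟩
      exact hΨ.hasDerivAt_path s hso _ _ (hU' s hso p) (flowValue_mem h s p))
  refine key.2.congr_deriv ?_
  have cD : Continuous fun p => gaussAvg √(2 * (T - t)) g' (y t p) :=
    ((h.gaussAvg √(2 * (T - t))).continuous').comp (hy t)
  have it : Integrable (fun p => Ψt t (flowValue T g t p)) (κ.prod (stdGaussian E)) :=
    Integrable.of_bound ct.aestronglyMeasurable Ct
      (Eventually.of_forall fun p => hCt t htc _ (flowValue_mem h t p))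
  have i1 : Integrable (fun p => Ψ₁ t (flowValue T g t p) * U' t p) (κ.prod (stdGaussian E)) :=
    hbi.mono' (c1.mul (hU'c t)).aestronglyMeasurable (Eventually.of_forall fun p => by
      rw [norm_mul]
      exact mul_le_mul (hC₁ t htc _ (flowValue_mem h t p))
        (hU'b t ⟨by linarith [ht.1], ht.2⟩ p) (norm_nonneg _) hC₁0)
  have i2 : Integrable (fun p => Ψ₂ t (flowValue T g t p)
      * ‖gaussAvg √(2 * (T - t)) g' (y t p)‖ ^ 2) (κ.prod (stdGaussian E)) :=
    Integrable.of_bound (c2.mul (by fun_prop)).aestronglyMeasurable (C₂ * K ^ 2)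
      (Eventually.of_forall fun p => by
        rw [norm_mul, norm_pow, norm_norm]
        gcongr
        exacts [hC₂ t htc _ (flowValue_mem h t p), (h.gaussAvg _).bound' _])
  rw [integral_add it i1, integral_add it i2, integral_prod _ i1, integral_prod _ i2]
  congr 1
  refine integral_congr_ae (Eventually.of_forall fun x => ?_)
  exact integral_flow_by_parts (h.gaussAvg √(2 * (T - t))) (φ := Ψ₁ t) (φ' := Ψ₂ t)
    (fun u hu => hΨ.hasDerivAt₁ t ht u hu)
    (hΨ.cont₂.comp (f := fun u => (t, u)) (by fun_prop) fun u hu => ⟨htc, hu⟩) x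
    (Real.sqrt_pos.2 (by linarith [ht.1]))

end Interpolation

/-! ### Log-Sobolev inequality after Gaussian smoothing. -/

section Hypercontractivity

set_option linter.unusedSectionVars false
set_option maxSynthPendingDepth 3
variable {E : Type*} [NormedAddCommGroup E] [InnerProductSpace ℝ E] [FiniteDimensional ℝ E]
  [MeasurableSpace E] [BorelSpace E]

/-- The log-Sobolev inequality `Ent(h) ≤ c ∫ ‖∇h‖² / h` for `C¹` functions `h` that are bounded,
bounded away from zero and have a bounded derivative. -/
def C1LogSobolev (ν : Measure E) (c : ℝ) : Prop :=
  ∀ (h : E → ℝ) (h' : E → E →L[ℝ] ℝ) (δ M K : ℝ), 0 < δ → (∀ x, h x ∈ Set.Icc δ M) →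
    (∀ x, HasFDerivAt h (h' x) x) → Continuous h' → (∀ x, ‖h' x‖ ≤ K) →
    ∫ x, h x * Real.log (h x) ∂ν - (∫ x, h x ∂ν) * Real.log (∫ x, h x ∂ν)
      ≤ c * ∫ x, ‖h' x‖ ^ 2 / h x ∂ν

variable {g : E → ℝ} {g' : E → E →L[ℝ] ℝ} {g'' : E → E →L[ℝ] E →L[ℝ] ℝ} {δ M K T : ℝ}

theorem integral_prod_translate (ν : Measure E) [IsProbabilityMeasure ν] {G : E → ℝ}
    (hG : Continuous G) {C : ℝ} (hC : ∀ x, ‖G x‖ ≤ C) (s : ℝ) :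
    ∫ p : E × E, G (p.1 + s • p.2) ∂(ν.prod (stdGaussian E)) = ∫ x, gaussAvg s G x ∂ν :=
  integral_prod _ (Integrable.of_bound (Continuous.aestronglyMeasurable (by fun_prop)) C
    (Eventually.of_forall fun _ => hC _))

theorem integral_prod_gaussAvg (ν : Measure E) [IsProbabilityMeasure ν] {G : E → ℝ}
    (hG : Continuous G) {C : ℝ} (hC : ∀ x, ‖G x‖ ≤ C) {a b c : ℝ} (h : a ^ 2 + b ^ 2 = c ^ 2) :
    ∫ p : E × E, gaussAvg b G (p.1 + a • p.2) ∂(ν.prod (stdGaussian E))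
      = ∫ x, gaussAvg c G x ∂ν := by
  rw [integral_prod_translate ν (continuous_gaussAvg_right hG hC b) (norm_gaussAvg_le hC b) a]
  exact integral_congr_ae (Eventually.of_forall fun x => gaussAvg_gaussAvg hG hC h x)

theorem integrable_gaussAvg (ν : Measure E) [IsProbabilityMeasure ν] {G : E → ℝ}
    (hG : Continuous G) {C : ℝ} (hC : ∀ x, ‖G x‖ ≤ C) (s : ℝ) : Integrable (gaussAvg s G) ν :=
  Integrable.of_bound (continuous_gaussAvg_right hG hC s).aestronglyMeasurable C
    (Eventually.of_forall fun _ => norm_gaussAvg_le hC _ _)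

theorem BoundedC2.continuous_fisher (h : BoundedC2 g g' g'' δ M K) (hδ : 0 < δ) :
    Continuous fun y => ‖g' y‖ ^ 2 / g y :=
  (h.continuous'.norm.pow 2).div h.continuous fun y => (hδ.trans_le (h.mem_Icc y).1).ne'

theorem BoundedC2.norm_fisher_le (h : BoundedC2 g g' g'' δ M K) (hδ : 0 < δ) (y : E) :
    ‖‖g' y‖ ^ 2 / g y‖ ≤ K ^ 2 / δ := by
  have := hδ.trans_le (h.mem_Icc y).1
  rw [Real.norm_of_nonneg (by positivity)]
  gcongr
  exacts [h.bound' y, (h.mem_Icc y).1]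

/-- The Gaussian average decreases the Fisher information density. -/
theorem BoundedC2.fisher_gaussAvg_le (h : BoundedC2 g g' g'' δ M K) (hδ : 0 < δ) (s : ℝ) (x : E) :
    ‖_root_.gaussAvg s g' x‖ ^ 2 / _root_.gaussAvg s g x
      ≤ _root_.gaussAvg s (fun y => ‖g' y‖ ^ 2 / g y) x := by
  have hB : 0 < _root_.gaussAvg s g x := hδ.trans_le ((h.gaussAvg s).mem_Icc x).1
  have hA : ‖_root_.gaussAvg s g' x‖ ≤ _root_.gaussAvg s (fun y => ‖g' y‖) x :=
    norm_integral_le_integral_norm _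
  set A := _root_.gaussAvg s (fun y => ‖g' y‖) x with hAdef
  set B := _root_.gaussAvg s g x with hBdef
  have i1 := integrable_comp_translate (g := fun y => ‖g' y‖) h.continuous'.norm (C := K)
    (fun y => by rw [norm_norm]; exact h.bound' y) s x
  have i2 := integrable_comp_translate h.continuous h.norm_le s x
  have i3 := integrable_comp_translate (h.continuous_fisher hδ) (h.norm_fisher_le hδ) s x
  -- Integrate `2λ ‖g'‖ ≤ λ² g + ‖g'‖² / g` with the optimal `λ = A / B`; this is the joint
  -- convexity of `‖v‖² / u`.
  have key : 2 * (A / B) * A ≤ (A / B) ^ 2 * B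
      + _root_.gaussAvg s (fun y => ‖g' y‖ ^ 2 / g y) x := by
    have e1 : 2 * (A / B) * A = ∫ z, 2 * (A / B) * ‖g' (x + s • z)‖ ∂(stdGaussian E) := by
      rw [integral_const_mul]; rfl
    have e2 : (A / B) ^ 2 * B + _root_.gaussAvg s (fun y => ‖g' y‖ ^ 2 / g y) x
        = ∫ z, ((A / B) ^ 2 * g (x + s • z) + ‖g' (x + s • z)‖ ^ 2 / g (x + s • z))
          ∂(stdGaussian E) := by
      rw [integral_add (i2.const_mul _) i3, integral_const_mul]; rfl
    rw [e1, e2]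
    refine integral_mono (i1.const_mul _) ((i2.const_mul _).add i3) fun z => ?_
    have hg := hδ.trans_le (h.mem_Icc (x + s • z)).1
    have : (A / B) ^ 2 * g (x + s • z) + ‖g' (x + s • z)‖ ^ 2 / g (x + s • z)
        - 2 * (A / B) * ‖g' (x + s • z)‖
        = ((A / B) * g (x + s • z) - ‖g' (x + s • z)‖) ^ 2 / g (x + s • z) := by
      field_simp; ring
    have h2 : 0 ≤ ((A / B) * g (x + s • z) - ‖g' (x + s • z)‖) ^ 2 / g (x + s • z) := by
      positivity
    show 2 * (A / B) * ‖g' (x + s • z)‖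
      ≤ (A / B) ^ 2 * g (x + s • z) + ‖g' (x + s • z)‖ ^ 2 / g (x + s • z)
    linarith
  have e : 2 * (A / B) * A - (A / B) ^ 2 * B = A ^ 2 / B := by field_simp; ring
  calc ‖_root_.gaussAvg s g' x‖ ^ 2 / B ≤ A ^ 2 / B := by gcongr
    _ ≤ _ := by linarith

theorem flowIntegrand_entropy (hδ : 0 < δ) :
    FlowIntegrand (fun _ u => u * Real.log u) (fun _ u => Real.log u + 1) (fun _ u => u⁻¹)
      (fun _ _ => 0) T δ M where
  cont := by
    refine ContinuousOn.mul continuousOn_snd (continuousOn_snd.log fun p hp => ?_)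
    exact (hδ.trans_le hp.2.1).ne'
  cont₁ := by
    refine ContinuousOn.add (continuousOn_snd.log fun p hp => ?_) continuousOn_const
    exact (hδ.trans_le hp.2.1).ne'
  cont₂ := continuousOn_snd.inv₀ fun p hp => (hδ.trans_le hp.2.1).ne'
  contt := continuousOn_const
  hasDerivAt_path := fun t _ v v' hv hvt => by
    have := (hδ.trans_le hvt.1).ne'
    refine (hv.mul (hv.log this)).congr_deriv ?_
    field_simp
    ring
  hasDerivAt₁ := fun t _ u hu => (Real.hasDerivAt_log (hδ.trans_le hu.1).ne').add_const 1

/-- The log-Sobolev inequality is preserved by Gaussian smoothing. -/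
theorem C1LogSobolev.entropy_gaussAvg_le {ν : Measure E} [IsProbabilityMeasure ν] {c : ℝ} (hc : 0 ≤ c)
    (hν : C1LogSobolev ν c) (hT : 0 < T) (h : BoundedC2 g g' g'' δ M K) (hδ : 0 < δ) :
    ∫ x, gaussAvg √(2 * T) (fun y => g y * Real.log (g y)) x ∂ν
      - (∫ x, gaussAvg √(2 * T) g x ∂ν) * Real.log (∫ x, gaussAvg √(2 * T) g x ∂ν)
      ≤ (c + T) * ∫ x, gaussAvg √(2 * T) (fun y => ‖g' y‖ ^ 2 / g y) x ∂ν := by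
  set I := ∫ x, gaussAvg √(2 * T) (fun y => ‖g' y‖ ^ 2 / g y) x ∂ν with hI
  have hF := flowIntegrand_entropy (T := T) (M := M) hδ
  have hHc := h.continuous_fisher hδ
  have hHb := h.norm_fisher_le hδ
  -- `J t` is the integral of `u log u` for the backward flow at time `t`. Its derivative is a
  -- Fisher information bounded by `I`, so `J` grows by at most `T * I`, while the log-Sobolev
  -- inequality of `ν`, applied to the fully smoothed `g`, contributes `c * I` at time `0`.
  let J : ℝ → ℝ := fun t => ∫ p, flowValue T g t p * Real.log (flowValue T g t p)
    ∂(ν.prod (stdGaussian E))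
  have hJc : ContinuousOn J (Set.Icc 0 T) := continuousOn_integral_flow ν h hF.cont
  have hJd : ∀ t ∈ Set.Ioo 0 T, HasDerivAt J (∫ p, ((flowValue T g t p)⁻¹
      * ‖gaussAvg √(2 * (T - t)) g' (p.1 + √(2 * t) • p.2)‖ ^ 2)
        ∂(ν.prod (stdGaussian E))) t := fun t ht => by
    simpa using! hasDerivAt_integral_flow ν h hF ht
  have hJle : ∀ t ∈ Set.Ioo 0 T, deriv J t ≤ I := fun t ht => by
    rw [(hJd t ht).deriv]
    set b := √(2 * (T - t))
    set a := √(2 * t)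
    have hab : a ^ 2 + b ^ 2 = √(2 * T) ^ 2 := by
      rw [Real.sq_sqrt (by linarith [ht.1]), Real.sq_sqrt (by linarith [ht.2]),
        Real.sq_sqrt (by linarith)]
      ring
    have hb := h.gaussAvg b
    have hcH : Continuous (gaussAvg b fun y => ‖g' y‖ ^ 2 / g y) :=
      continuous_gaussAvg_right hHc hHb b
    have e : ∫ p : E × E, gaussAvg b (fun y => ‖g' y‖ ^ 2 / g y) (p.1 + a • p.2)
        ∂(ν.prod (stdGaussian E)) = I := integral_prod_gaussAvg ν hHc hHb hab
    rw [← e]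
    have hle : ∀ p : E × E, (flowValue T g t p)⁻¹ * ‖gaussAvg b g' (p.1 + a • p.2)‖ ^ 2
        ≤ gaussAvg b (fun y => ‖g' y‖ ^ 2 / g y) (p.1 + a • p.2) := fun p => by
      rw [inv_mul_eq_div]
      exact h.fisher_gaussAvg_le hδ b _
    refine integral_mono_of_nonneg (Eventually.of_forall fun p => ?_)
      (Integrable.of_bound (Continuous.aestronglyMeasurable (by fun_prop)) _
        (Eventually.of_forall fun p => norm_gaussAvg_le hHb b _))
      (Eventually.of_forall hle)
    have := hδ.trans_le (flowValue_mem (T := T) h t p).1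
    show 0 ≤ (flowValue T g t p)⁻¹ * ‖gaussAvg b g' (p.1 + a • p.2)‖ ^ 2
    positivity
  have hmv : J T - J 0 ≤ I * (T - 0) :=
    Convex.image_sub_le_mul_sub_of_deriv_le (convex_Icc 0 T) hJc
      (by rw [interior_Icc]; exact fun t ht => (hJd t ht).differentiableAt.differentiableWithinAt)
      (by rw [interior_Icc]; exact hJle) 0 (Set.left_mem_Icc.2 hT.le) T
      (Set.right_mem_Icc.2 hT.le) hT.le
  have hgl : Continuous fun y => g y * Real.log (g y) :=
    h.continuous.mul (h.continuous.log fun y => (hδ.trans_le (h.mem_Icc y).1).ne')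
  obtain ⟨C, hC⟩ := isCompact_Icc.exists_bound_of_continuousOn
    (s := Set.Icc δ M) (f := fun u => u * Real.log u) Real.continuous_mul_log.continuousOn
  have hJT : J T = ∫ x, gaussAvg √(2 * T) (fun y => g y * Real.log (g y)) x ∂ν := by
    rw [← integral_prod_translate ν hgl (fun y => hC _ (h.mem_Icc y))]
    simp [J, flowValue, gaussAvg]
  have hJ0 : J 0 = ∫ x, gaussAvg √(2 * T) g x
      * Real.log (gaussAvg √(2 * T) g x) ∂ν := by
    have hb := h.gaussAvg √(2 * T)
    have := integral_prod_translate ν (G := fun y => gaussAvg √(2 * T) g y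
      * Real.log (gaussAvg √(2 * T) g y)) (hb.continuous.mul (hb.continuous.log fun y =>
        (hδ.trans_le (hb.mem_Icc y).1).ne')) (fun y => hC _ (hb.mem_Icc y)) 0
    simpa [J, flowValue, gaussAvg] using this
  have hb := h.gaussAvg √(2 * T)
  have hlsi := hν _ _ δ M K hδ hb.mem_Icc hb.hasFDerivAt hb.continuous' hb.bound'
  have hle : ∫ x, ‖gaussAvg √(2 * T) g' x‖ ^ 2 / gaussAvg √(2 * T) g x ∂ν ≤ I :=
    integral_mono (Integrable.of_bound (hb.continuous_fisher hδ).aestronglyMeasurable _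
      (Eventually.of_forall (hb.norm_fisher_le hδ)))
      (integrable_gaussAvg ν hHc hHb _) (h.fisher_gaussAvg_le hδ _)
  have := mul_le_mul_of_nonneg_left hle hc
  rw [← hJT]
  rw [← hJ0] at hlsi
  linarith

end Hypercontractivity

/-! ### Hypercontractivity along a varying exponent. -/

section HypercontractivityPower

set_option linter.unusedSectionVars false
set_option maxSynthPendingDepth 3
variable {E : Type*} [NormedAddCommGroup E] [InnerProductSpace ℝ E] [FiniteDimensional ℝ E]
  [MeasurableSpace E] [BorelSpace E]
variable {g : E → ℝ} {g' : E → E →L[ℝ] ℝ} {g'' : E → E →L[ℝ] E →L[ℝ] ℝ} {δ M K T : ℝ}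

theorem flowIntegrand_rpow (hδ : 0 < δ) {p p' : ℝ → ℝ} (hp : ContinuousOn p (Set.Icc 0 T))
    (hp' : ContinuousOn p' (Set.Icc 0 T)) (hd : ∀ t ∈ Set.Ioo 0 T, HasDerivAt p (p' t) t) :
    FlowIntegrand (fun t u => u ^ p t) (fun t u => p t * u ^ (p t - 1))
      (fun t u => p t * ((p t - 1) * u ^ (p t - 2))) (fun t u => p' t * (u ^ p t * Real.log u))
      T δ M := by
  have c1 : ContinuousOn (fun q : ℝ × ℝ => p q.1) (Set.Icc 0 T ×ˢ Set.Icc δ M) :=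
    hp.comp continuousOn_fst fun q hq => hq.1
  have c2 : ContinuousOn (fun q : ℝ × ℝ => p' q.1) (Set.Icc 0 T ×ˢ Set.Icc δ M) :=
    hp'.comp continuousOn_fst fun q hq => hq.1
  have hpos : ∀ q ∈ Set.Icc 0 T ×ˢ Set.Icc δ M, q.2 ≠ 0 := fun q hq => (hδ.trans_le hq.2.1).ne'
  have c3 : ∀ r : ℝ, ContinuousOn (fun q : ℝ × ℝ => q.2 ^ (p q.1 - r))
      (Set.Icc 0 T ×ˢ Set.Icc δ M) := fun r =>
    continuousOn_snd.rpow (c1.sub continuousOn_const) fun q hq => Or.inl (hpos q hq)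
  have c4 : ContinuousOn (fun q : ℝ × ℝ => q.2 ^ p q.1) (Set.Icc 0 T ×ˢ Set.Icc δ M) := by
    simpa using c3 0
  exact
  { cont := c4
    cont₁ := c1.mul (c3 1)
    cont₂ := c1.mul ((c1.sub continuousOn_const).mul (c3 2))
    contt := c2.mul (c4.mul (continuousOn_snd.log hpos))
    hasDerivAt_path := fun t ht v v' hv hvt => by
      refine (hv.rpow (hd t ht) (hδ.trans_le hvt.1)).congr_deriv ?_
      ring
    hasDerivAt₁ := fun t ht u hu => by
      have := (Real.hasDerivAt_rpow_const (p := p t - 1)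
        (Or.inl (hδ.trans_le hu.1).ne')).const_mul (p t)
      refine this.congr_deriv ?_
      rw [show p t - 1 - 1 = p t - 2 by ring] }

/-- The entropy of `u ^ p` under Gaussian smoothing of a measure with a log-Sobolev inequality. -/
theorem C1LogSobolev.entropy_rpow_le {ν : Measure E} [IsProbabilityMeasure ν] {c : ℝ} (hc : 0 ≤ c)
    (hν : C1LogSobolev ν c) {t : ℝ} (ht : 0 < t) (h : BoundedC2 g g' g'' δ M K) (hδ : 0 < δ)
    {p : ℝ} (hp : 0 < p) :
    p * (∫ x, gaussAvg √(2 * t) (fun y => g y ^ p * Real.log (g y)) x ∂ν)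
      - (∫ x, gaussAvg √(2 * t) (fun y => g y ^ p) x ∂ν)
        * Real.log (∫ x, gaussAvg √(2 * t) (fun y => g y ^ p) x ∂ν)
      ≤ (c + t) * (p ^ 2
        * ∫ x, gaussAvg √(2 * t) (fun y => g y ^ (p - 2) * ‖g' y‖ ^ 2) x ∂ν) := by
  have hpos : ∀ u ∈ Set.Icc δ M, u ≠ 0 := fun u hu => (hδ.trans_le hu.1).ne'
  -- Apply the smoothed inequality to `g ^ p`, whose Fisher density is `p² g^(p-2) ‖dg‖²`.
  obtain ⟨V', C, hG⟩ := h.exists_comp (ψ := fun u => u ^ p) (φ := fun u => p * u ^ (p - 1))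
    (φ' := fun u => p * ((p - 1) * u ^ (p - 1 - 1)))
    (fun u hu => Real.hasDerivAt_rpow_const (Or.inl (hpos u hu)))
    (fun u hu => (Real.hasDerivAt_rpow_const (Or.inl (hpos u hu))).const_mul p)
    (continuousOn_const.mul (continuousOn_const.mul
      (continuousOn_id.rpow_const fun u hu => Or.inl (hpos u hu))))
    (δ' := δ ^ p) (M' := M ^ p)
    (fun u hu => ⟨Real.rpow_le_rpow hδ.le hu.1 hp.le,
      Real.rpow_le_rpow (hδ.le.trans hu.1) hu.2 hp.le⟩)
  have key := hν.entropy_gaussAvg_le hc ht hG (Real.rpow_pos_of_pos hδ p)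
  have hgp : ∀ y, 0 < g y := fun y => hδ.trans_le (h.mem_Icc y).1
  have e1 : (fun y => g y ^ p * Real.log (g y ^ p))
      = fun y => p * (g y ^ p * Real.log (g y)) := by
    ext y; rw [Real.log_rpow (hgp y)]; ring
  have e2 : (fun y => ‖(p * g y ^ (p - 1)) • g' y‖ ^ 2 / g y ^ p)
      = fun y => p ^ 2 * (g y ^ (p - 2) * ‖g' y‖ ^ 2) := by
    ext y
    rw [norm_smul, Real.norm_of_nonneg (by have := hgp y; positivity), mul_pow, mul_pow,
      Real.rpow_sub (hgp y) p 1, Real.rpow_sub (hgp y) p 2, Real.rpow_one, Real.rpow_ofNat]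
    have := (hgp y).ne'
    have := (Real.rpow_pos_of_pos (hgp y) p).ne'
    field_simp
  have e3 : ∀ (s r : ℝ) (G : E → ℝ) , ∫ x, gaussAvg s (fun y => r * G y) x ∂ν
      = r * ∫ x, gaussAvg s G x ∂ν := fun s r G => by
    simp only [gaussAvg, integral_const_mul]
  rw [e1, e2, e3, e3] at key
  exact key

/-- Hypercontractivity of Gaussian averages under a log-Sobolev inequality. -/
theorem C1LogSobolev.hypercontractive {ν : Measure E} [IsProbabilityMeasure ν] {c : ℝ} (hc : 0 < c)
    (hν : C1LogSobolev ν c) (hT : 0 < T) (h : BoundedC2 g g' g'' δ M K) (hδ : 0 < δ)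
    {r s : ℝ} (hr : 1 < r) (hs : s = 1 + (r - 1) * (c + T) / c) :
    (∫ x, gaussAvg √(2 * T) g x ^ s ∂ν) ^ (1 / s)
      ≤ (∫ x, gaussAvg √(2 * T) (fun y => g y ^ r) x ∂ν) ^ (1 / r) := by
  -- The exponent falls from `s` at time `0` to `r` at time `T`. Its equation `p' = -(p - 1) / (c +
  -- t)` is dictated by the log-Sobolev factor `c + t` available at time `t`.
  let p : ℝ → ℝ := fun t => 1 + (r - 1) * (c + T) / (c + t)
  let p' : ℝ → ℝ := fun t => -((p t - 1) / (c + t))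
  have hct : ∀ t ∈ Set.Icc 0 T, 0 < c + t := fun t ht => by linarith [ht.1]
  have hp1 : ∀ t ∈ Set.Icc 0 T, 1 < p t := fun t ht => by
    have := hct t ht
    have h1 : 0 < r - 1 := by linarith
    have : 0 < (r - 1) * (c + T) / (c + t) := by positivity
    simp only [p]; linarith
  have hpd : ∀ t ∈ Set.Icc 0 T, HasDerivAt p (p' t) t := fun t ht => by
    have h1 := (hct t ht).ne'
    have := ((hasDerivAt_const t ((r - 1) * (c + T))).div ((hasDerivAt_id t).const_add c) h1).const_add 1
    refine this.congr_deriv ?_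
    simp only [p', p, id]
    field_simp
    ring
  have hpc : ContinuousOn p (Set.Icc 0 T) := fun t ht =>
    (hpd t ht).continuousAt.continuousWithinAt
  have hp'c : ContinuousOn p' (Set.Icc 0 T) :=
    ((hpc.sub continuousOn_const).div (by fun_prop) fun t ht => (hct t ht).ne').neg
  have hF := flowIntegrand_rpow (M := M) hδ hpc hp'c fun t ht => hpd t ⟨ht.1.le, ht.2.le⟩
  set W : ℝ → ℝ := fun t => ∫ q, flowValue T g t q ^ p t ∂(ν.prod (stdGaussian E)) with hW
  have hWc : ContinuousOn W (Set.Icc 0 T) := continuousOn_integral_flow ν h hF.cont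
  have hu : ∀ t q, 0 < flowValue T g t q := fun t q => hδ.trans_le (flowValue_mem h t q).1
  have hWpos : ∀ t ∈ Set.Icc 0 T, 0 < W t := fun t ht => by
    have hcont : Continuous fun q => flowValue T g t q ^ p t :=
      continuousOn_slice hF.cont ht ((continuous_flowValue h).comp (Continuous.prodMk_right t))
        (flowValue_mem h t)
    obtain ⟨C, -, hC⟩ := exists_bound_slice hF.cont
    have : δ ^ p t ≤ W t := by
      simpa using! integral_mono (μ := ν.prod (stdGaussian E)) (integrable_const (δ ^ p t))
        (Integrable.of_bound hcont.aestronglyMeasurable C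
          (Eventually.of_forall fun q => hC t ht _ (flowValue_mem h t q)))
        (fun q => Real.rpow_le_rpow hδ.le (flowValue_mem h t q).1 (by linarith [hp1 t ht]))
    exact (Real.rpow_pos_of_pos hδ _).trans_le this
  -- `Φ t` is the logarithm of the `L^{p t}` norm of the flow at time `t`, so the claim is `Φ 0 ≤ Φ
  -- T`.
  set Φ : ℝ → ℝ := fun t => Real.log (W t) / p t with hΦ
  have hΦc : ContinuousOn Φ (Set.Icc 0 T) :=
    (hWc.log fun t ht => (hWpos t ht).ne').div hpc fun t ht => by linarith [hp1 t ht]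
  have hder : ∀ t ∈ Set.Ioo 0 T, ∃ d, 0 ≤ d ∧ HasDerivAt Φ d t := fun t ht => by
    have htc : t ∈ Set.Icc 0 T := ⟨ht.1.le, ht.2.le⟩
    have hub := h.gaussAvg √(2 * (T - t))
    set u := gaussAvg √(2 * (T - t)) g with hudef
    set u' := gaussAvg √(2 * (T - t)) g' with hu'def
    have hup : ∀ y, 0 < u y := fun y => hδ.trans_le (hub.mem_Icc y).1
    have hent := hν.entropy_rpow_le hc.le ht.1 hub hδ (p := p t) (by linarith [hp1 t htc])
    have hcont : ∀ a : ℝ, Continuous fun y => u y ^ a := fun a =>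
      hub.continuous.rpow_const fun y => Or.inl (hup y).ne'
    have hbdd : ∀ a : ℝ, ∃ C, ∀ y, ‖u y ^ a‖ ≤ C := fun a => by
      obtain ⟨C, hC⟩ := isCompact_Icc.exists_bound_of_continuousOn (s := Set.Icc δ M)
        (f := fun v : ℝ => v ^ a)
        (continuousOn_id.rpow_const fun v hv => Or.inl (hδ.trans_le hv.1).ne')
      exact ⟨C, fun y => hC _ (hub.mem_Icc y)⟩
    have hlogc : Continuous fun y => Real.log (u y) :=
      hub.continuous.log fun y => (hup y).ne'
    obtain ⟨CL, hCL⟩ : ∃ C, ∀ y, ‖Real.log (u y)‖ ≤ C := by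
      obtain ⟨C, hC⟩ := isCompact_Icc.exists_bound_of_continuousOn (s := Set.Icc δ M)
        (f := Real.log) (continuousOn_id.log fun v hv => (hδ.trans_le hv.1).ne')
      exact ⟨C, fun y => hC _ (hub.mem_Icc y)⟩
    obtain ⟨Cp, hCp⟩ := hbdd (p t)
    obtain ⟨Cq, hCq⟩ := hbdd (p t - 2)
    have hAc : Continuous fun y => u y ^ p t * Real.log (u y) := (hcont _).mul hlogc
    have hAb : ∀ y, ‖u y ^ p t * Real.log (u y)‖ ≤ Cp * CL := fun y => by
      rw [norm_mul]
      exact mul_le_mul (hCp y) (hCL y) (norm_nonneg _) ((norm_nonneg _).trans (hCp y))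
    have hBc : Continuous fun y => u y ^ (p t - 2) * ‖u' y‖ ^ 2 :=
      (hcont _).mul (hub.continuous'.norm.pow 2)
    have hBb : ∀ y, ‖u y ^ (p t - 2) * ‖u' y‖ ^ 2‖ ≤ Cq * K ^ 2 := fun y => by
      rw [norm_mul, norm_pow, norm_norm]
      exact mul_le_mul (hCq y) (pow_le_pow_left₀ (norm_nonneg _) (hub.bound' y) 2) (by positivity)
        ((norm_nonneg _).trans (hCq y))
    set A := ∫ x, gaussAvg √(2 * t) (fun y => u y ^ p t * Real.log (u y)) x ∂ν
    set B := ∫ x, gaussAvg √(2 * t) (fun y => u y ^ (p t - 2) * ‖u' y‖ ^ 2) x ∂ν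
    have hWt : W t = ∫ x, gaussAvg √(2 * t) (fun y => u y ^ p t) x ∂ν :=
      integral_prod_translate ν (hcont (p t)) hCp √(2 * t)
    rw [← hWt] at hent
    have hWd : HasDerivAt W (p' t * A + p t * ((p t - 1) * B)) t := by
      refine (hasDerivAt_integral_flow ν h hF ht).congr_deriv ?_
      have iA : Integrable (fun q : E × E => u (q.1 + √(2 * t) • q.2) ^ p t
          * Real.log (u (q.1 + √(2 * t) • q.2))) (ν.prod (stdGaussian E)) :=
        Integrable.of_bound (hAc.comp (by fun_prop)).aestronglyMeasurable _
          (Eventually.of_forall fun q => hAb _)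
      have iB : Integrable (fun q : E × E => u (q.1 + √(2 * t) • q.2) ^ (p t - 2)
          * ‖u' (q.1 + √(2 * t) • q.2)‖ ^ 2) (ν.prod (stdGaussian E)) :=
        Integrable.of_bound (hBc.comp (by fun_prop)).aestronglyMeasurable _
          (Eventually.of_forall fun q => hBb _)
      have eA := integral_prod_translate ν hAc hAb √(2 * t)
      have eB := integral_prod_translate ν hBc hBb √(2 * t)
      rw [show A = _ from eA.symm, show B = _ from eB.symm, ← integral_const_mul,
        ← integral_const_mul, ← integral_const_mul, ← integral_add (iA.const_mul _)
          ((iB.const_mul _).const_mul _)]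
      refine integral_congr_ae (Eventually.of_forall fun q => ?_)
      simp only [flowValue, hudef, hu'def]
      ring
    have hpt : 0 < p t := by linarith [hp1 t htc]
    have hWp := hWpos t htc
    have hctt := hct t htc
    refine ⟨_, ?_, (hWd.log hWp.ne').div (hpd t htc) hpt.ne'⟩
    refine div_nonneg ?_ (by positivity)
    -- With this `p'`, the numerator of the derivative of `Φ` is a positive multiple of the deficit
    -- in the log-Sobolev inequality for `u ^ p t`.
    have e : (p' t * A + p t * ((p t - 1) * B)) / W t * p t - Real.log (W t) * p' t
        = ((p t - 1) / (c + t)) / W t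
          * ((c + t) * (p t ^ 2 * B) - (p t * A - W t * Real.log (W t))) := by
      simp only [p']
      field_simp
      ring
    rw [e]
    have : 0 ≤ p t - 1 := by linarith [hp1 t htc]
    exact mul_nonneg (by positivity) (by linarith)
  have hmono : MonotoneOn Φ (Set.Icc 0 T) := by
    refine monotoneOn_of_deriv_nonneg (convex_Icc 0 T) hΦc ?_ ?_
    · rw [interior_Icc]
      intro t ht
      obtain ⟨d, -, hd⟩ := hder t ht
      exact hd.differentiableAt.differentiableWithinAt
    · rw [interior_Icc]
      intro t ht
      obtain ⟨d, hd0, hd⟩ := hder t ht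
      rwa [hd.deriv]
  have hle := hmono (Set.left_mem_Icc.2 hT.le) (Set.right_mem_Icc.2 hT.le) hT.le
  have hp0 : p 0 = s := by simp [p, hs]
  have hpT : p T = r := by
    have : c + T ≠ 0 := by positivity
    simp only [p]; field_simp; ring
  have hrpow : ∀ a : ℝ, Continuous fun y => g y ^ a := fun a =>
    h.continuous.rpow_const fun y => Or.inl (hδ.trans_le (h.mem_Icc y).1).ne'
  have hb := h.gaussAvg √(2 * T)
  have hW0 : W 0 = ∫ x, gaussAvg √(2 * T) g x ^ s ∂ν := by
    obtain ⟨C, hC⟩ := isCompact_Icc.exists_bound_of_continuousOn (s := Set.Icc δ M)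
      (f := fun v : ℝ => v ^ s)
      (continuousOn_id.rpow_const fun v hv => Or.inl (hδ.trans_le hv.1).ne')
    have := integral_prod_translate ν (G := fun y => gaussAvg √(2 * T) g y ^ s)
      (hb.continuous.rpow_const fun y => Or.inl (hδ.trans_le (hb.mem_Icc y).1).ne')
      (fun y => hC _ (hb.mem_Icc y)) 0
    simpa [W, hp0, flowValue, gaussAvg] using this
  have hWT : W T = ∫ x, gaussAvg √(2 * T) (fun y => g y ^ r) x ∂ν := by
    obtain ⟨C, hC⟩ := isCompact_Icc.exists_bound_of_continuousOn (s := Set.Icc δ M)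
      (f := fun v : ℝ => v ^ r)
      (continuousOn_id.rpow_const fun v hv => Or.inl (hδ.trans_le hv.1).ne')
    rw [← integral_prod_translate ν (hrpow r) (fun y => hC _ (h.mem_Icc y))]
    simp [W, hpT, flowValue, gaussAvg]
  have h0 := hWpos 0 (Set.left_mem_Icc.2 hT.le)
  have hTp := hWpos T (Set.right_mem_Icc.2 hT.le)
  simp only [hΦ, hp0, hpT] at hle
  rw [← hW0, ← hWT, Real.rpow_def_of_pos h0, Real.rpow_def_of_pos hTp]
  refine Real.exp_le_exp.2 ?_
  rw [mul_one_div, mul_one_div]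
  exact hle

end HypercontractivityPower

/-! ### Extending the log-Sobolev inequality beyond smooth densities. -/

section FromSmooth
open scoped Convolution

set_option linter.unusedSectionVars false
set_option maxSynthPendingDepth 3

theorem norm_gradient {n : ℕ} (f : EuclideanSpace ℝ (Fin n) → ℝ) (x : EuclideanSpace ℝ (Fin n)) :
    ‖gradient f x‖ = ‖fderiv ℝ f x‖ := by
  rw [gradient, LinearIsometryEquiv.norm_map]

/-- The entropy form of the log-Sobolev inequality for a positive bounded smooth function whose
second moment is finite. -/
theorem LogSobolev.entropy_le {n : ℕ} {ν : Measure (EuclideanSpace ℝ (Fin n))}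
    [IsProbabilityMeasure ν] {β : ℝ} (hν : LogSobolev ν β) {h : EuclideanSpace ℝ (Fin n) → ℝ}
    {D : EuclideanSpace ℝ (Fin n) → EuclideanSpace ℝ (Fin n) →L[ℝ] ℝ} {M C C' : ℝ}
    (hsm : ContDiff ℝ (⊤ : ℕ∞) h) (hpos : ∀ x, 0 < h x) (hM : ∀ x, h x ≤ M)
    (hD : ∀ x, HasFDerivAt (fun y => Real.log (h y)) (D x) x)
    (hDc : Continuous D) (hC : ∀ x, ‖D x‖ ^ 2 * h x ≤ C) (hC' : ∀ x, ‖x‖ ^ 2 * h x ≤ C') :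
    ∫ x, h x * Real.log (h x) ∂ν - (∫ x, h x ∂ν) * Real.log (∫ x, h x ∂ν)
      ≤ 1 / (2 * β) * ∫ x, ‖D x‖ ^ 2 * h x ∂ν := by
  obtain ⟨hβ, H⟩ := hν
  have hc := hsm.continuous
  have hi : Integrable h ν := Integrable.of_bound hc.aestronglyMeasurable M
    (Eventually.of_forall fun x => by rw [Real.norm_of_nonneg (hpos x).le]; exact hM x)
  set Z := ∫ x, h x ∂ν with hZdef
  have hZ : 0 < Z := (integral_pos_iff_support_of_nonneg (fun x => (hpos x).le) hi).2 (by
    have : Function.support h = Set.univ := by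
      ext x; simpa using (hpos x).ne'
    rw [this]; simp)
  -- Both sides are homogeneous of degree one in `h`, so it suffices to treat the probability
  -- density `h / Z`.
  set ρ : EuclideanSpace ℝ (Fin n) → ℝ := fun x => Z⁻¹ * h x with hρ
  have hρpos : ∀ x, 0 < ρ x := fun x => mul_pos (inv_pos.2 hZ) (hpos x)
  have hρi : Integrable ρ ν := hi.const_mul _
  have hρ1 : ∫ x, ρ x ∂ν = 1 := by
    rw [integral_const_mul]; exact inv_mul_cancel₀ hZ.ne'
  have hρc : Continuous ρ := continuous_const.mul hc
  have hρm : Measurable fun x => ENNReal.ofReal (ρ x) := hρc.measurable.ennreal_ofReal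
  set m := ν.withDensity fun x => ENNReal.ofReal (ρ x) with hm
  have hprob : IsProbabilityMeasure m := ⟨by
    rw [hm, withDensity_apply _ MeasurableSet.univ, Measure.restrict_univ,
      ← ofReal_integral_eq_lintegral_ofReal hρi (Eventually.of_forall fun x => (hρpos x).le), hρ1,
      ENNReal.ofReal_one]⟩
  have hmom : Integrable (fun x => ‖x‖ ^ 2) m := by
    rw [hm, integrable_withDensity_iff_integrable_smul' hρm
      (Eventually.of_forall fun x => ENNReal.ofReal_lt_top)]
    refine Integrable.of_bound (Continuous.aestronglyMeasurable ?_) (Z⁻¹ * C')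
      (Eventually.of_forall fun x => ?_)
    · simp only [fun x => ENNReal.toReal_ofReal (hρpos x).le]
      fun_prop
    · rw [ENNReal.toReal_ofReal (hρpos x).le, smul_eq_mul, norm_mul, norm_pow, norm_norm,
        Real.norm_of_nonneg (hρpos x).le, hρ]
      simp only [mul_assoc]
      gcongr
      rw [mul_comm]; exact hC' x
  have hlsi := H ρ (contDiff_const.mul hsm) (fun x => (hρpos x).le) hprob hmom
  have hρD : ∀ x, HasFDerivAt (fun y => Real.log (ρ y)) (D x) x := fun x => by
    have e : (fun y => Real.log (ρ y)) = fun y => Real.log Z⁻¹ + Real.log (h y) := by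
      ext y; exact Real.log_mul (inv_pos.2 hZ).ne' (hpos y).ne'
    rw [e]
    exact (hD x).const_add _
  have hFi : Integrable (fun x => ρ x * ‖D x‖ ^ 2) ν :=
    Integrable.of_bound (Continuous.aestronglyMeasurable (by fun_prop)) (Z⁻¹ * C)
      (Eventually.of_forall fun x => by
        rw [Real.norm_of_nonneg (mul_nonneg (hρpos x).le (sq_nonneg _)), hρ]
        simp only [mul_assoc]
        gcongr
        rw [mul_comm]; exact hC x)
  have hfisher : fisherInfo ν ρ = ENNReal.ofReal (∫ x, ρ x * ‖D x‖ ^ 2 ∂ν) := by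
    have hmeas : Measurable fun x => ‖gradient (fun y => Real.log (ρ y)) x‖ₑ ^ 2 := by
      have : (fun x => ‖gradient (fun y => Real.log (ρ y)) x‖ₑ ^ 2)
          = fun x => ENNReal.ofReal (‖D x‖ ^ 2) := by
        ext x
        rw [← ofReal_norm, norm_gradient, (hρD x).fderiv, ENNReal.ofReal_pow (norm_nonneg _)]
      rw [this]
      exact (Continuous.measurable (by fun_prop)).ennreal_ofReal
    rw [fisherInfo, lintegral_withDensity_eq_lintegral_mul _ hρm hmeas,
      ofReal_integral_eq_lintegral_ofReal hFi
        (Eventually.of_forall fun x => mul_nonneg (hρpos x).le (sq_nonneg _))]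
    refine lintegral_congr fun x => ?_
    rw [Pi.mul_apply, ENNReal.ofReal_mul (hρpos x).le, ← ofReal_norm, norm_gradient,
      (hρD x).fderiv, ENNReal.ofReal_pow (norm_nonneg _)]
  have hac : m ≪ ν := withDensity_absolutelyContinuous _ _
  obtain ⟨B, hB⟩ := (isCompact_Icc (a := 0) (b := Z⁻¹ * M)).exists_bound_of_continuousOn
    Real.continuous_mul_log.continuousOn
  have hei : Integrable (fun x => ρ x * Real.log (ρ x)) ν :=
    Integrable.of_bound (Real.continuous_mul_log.comp hρc).aestronglyMeasurable B
      (Eventually.of_forall fun x => hB (ρ x) ⟨(hρpos x).le, by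
        simp only [hρ]; gcongr; exact hM x⟩)
  have hkl : InformationTheory.klDiv m ν = ENNReal.ofReal (∫ x, ρ x * Real.log (ρ x) ∂ν) := by
    have hkf : ∀ x, InformationTheory.klFun (ρ x) = ρ x * Real.log (ρ x) + 1 - ρ x := fun x => rfl
    have i1 : Integrable (fun x => ρ x * Real.log (ρ x) + 1) ν := hei.add (integrable_const 1)
    have i2 : Integrable (fun x => InformationTheory.klFun (ρ x)) ν := i1.sub hρi
    have e : ∫ x, ρ x * Real.log (ρ x) ∂ν = ∫ x, InformationTheory.klFun (ρ x) ∂ν := by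
      simp only [hkf]
      rw [integral_sub i1 hρi, integral_add hei (integrable_const 1),
        hρ1]
      simp
    rw [e, InformationTheory.klDiv_eq_lintegral_klFun_of_ac hac,
      ofReal_integral_eq_lintegral_ofReal i2
        (Eventually.of_forall fun x => InformationTheory.klFun_nonneg (hρpos x).le)]
    refine lintegral_congr_ae ?_
    filter_upwards [Measure.rnDeriv_withDensity ν hρm] with x hx
    rw [hx, ENNReal.toReal_ofReal (hρpos x).le]
  rw [hkl, hfisher, ← ENNReal.ofReal_mul (by positivity)] at hlsi
  have hnn : 0 ≤ 1 / (2 * β) * ∫ x, ρ x * ‖D x‖ ^ 2 ∂ν :=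
    mul_nonneg (by positivity) (integral_nonneg fun x => mul_nonneg (hρpos x).le (sq_nonneg _))
  have hreal := (ENNReal.ofReal_le_ofReal_iff hnn).1 hlsi
  obtain ⟨B', hB'⟩ := (isCompact_Icc (a := 0) (b := M)).exists_bound_of_continuousOn
    Real.continuous_mul_log.continuousOn
  have hhi : Integrable (fun x => h x * Real.log (h x)) ν :=
    Integrable.of_bound (Real.continuous_mul_log.comp hc).aestronglyMeasurable B'
      (Eventually.of_forall fun x => hB' (h x) ⟨(hpos x).le, hM x⟩)
  have e1 : ∫ x, ρ x * Real.log (ρ x) ∂ν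
      = Z⁻¹ * (∫ x, h x * Real.log (h x) ∂ν - Z * Real.log Z) := by
    have : ∀ x, ρ x * Real.log (ρ x) = Z⁻¹ * (h x * Real.log (h x) - h x * Real.log Z) := fun x => by
      simp only [hρ]
      rw [Real.log_mul (inv_pos.2 hZ).ne' (hpos x).ne', Real.log_inv]
      ring
    simp only [this]
    rw [integral_const_mul, integral_sub hhi (hi.mul_const _), integral_mul_const]
  have e2 : ∫ x, ρ x * ‖D x‖ ^ 2 ∂ν = Z⁻¹ * ∫ x, ‖D x‖ ^ 2 * h x ∂ν := by
    rw [← integral_const_mul]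
    refine integral_congr_ae (Eventually.of_forall fun x => ?_)
    simp only [hρ]; ring
  rw [e1, e2, mul_left_comm] at hreal
  exact le_of_mul_le_mul_left hreal (inv_pos.2 hZ)

/-- The entropy form of the log-Sobolev inequality for smooth functions that are bounded, bounded
away from zero and have a bounded derivative. -/
theorem LogSobolev.entropy_le_of_contDiff {n : ℕ} {ν : Measure (EuclideanSpace ℝ (Fin n))}
    [IsProbabilityMeasure ν] {β : ℝ} (hν : LogSobolev ν β) {h : EuclideanSpace ℝ (Fin n) → ℝ}
    {h' : EuclideanSpace ℝ (Fin n) → EuclideanSpace ℝ (Fin n) →L[ℝ] ℝ} {δ M K : ℝ} (hδ : 0 < δ)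
    (hsm : ContDiff ℝ (⊤ : ℕ∞) h) (hmem : ∀ x, h x ∈ Set.Icc δ M)
    (hD : ∀ x, HasFDerivAt h (h' x) x) (hDc : Continuous h') (hK : ∀ x, ‖h' x‖ ≤ K) :
    ∫ x, h x * Real.log (h x) ∂ν - (∫ x, h x ∂ν) * Real.log (∫ x, h x ∂ν)
      ≤ 1 / (2 * β) * ∫ x, ‖h' x‖ ^ 2 / h x ∂ν := by
  have hpos : ∀ x, 0 < h x := fun x => hδ.trans_le (hmem x).1
  have hc := hsm.continuous
  have hM0 : 0 < M := hδ.trans_le ((hmem 0).1.trans (hmem 0).2)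
  have hK0 : 0 ≤ K := (norm_nonneg _).trans (hK 0)
  -- The measure `ν` may have infinite second moment. The Gaussian weight `w η` makes that of `h * w
  -- η` finite, and it is removed by dominated convergence as `η → 0`.
  let w : ℝ → EuclideanSpace ℝ (Fin n) → ℝ := fun η x => Real.exp (-(η * ‖x‖ ^ 2))
  let D : ℝ → EuclideanSpace ℝ (Fin n) → EuclideanSpace ℝ (Fin n) →L[ℝ] ℝ := fun η x =>
    (h x)⁻¹ • h' x - (2 * η) • innerSL ℝ x
  have hw : ∀ η x, 0 < w η x := fun η x => Real.exp_pos _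
  have hw1 : ∀ η, 0 ≤ η → ∀ x, w η x ≤ 1 := fun η hη x =>
    Real.exp_le_one_iff.2 (neg_nonpos.2 (by positivity))
  have hwx : ∀ η x, η * ‖x‖ ^ 2 * w η x ≤ 1 := fun η x => by
    have h1 : η * ‖x‖ ^ 2 ≤ Real.exp (η * ‖x‖ ^ 2) := by
      linarith [Real.add_one_le_exp (η * ‖x‖ ^ 2)]
    calc η * ‖x‖ ^ 2 * w η x ≤ Real.exp (η * ‖x‖ ^ 2) * w η x := by gcongr
      _ = 1 := by rw [← Real.exp_add]; simp
  have hDcont : ∀ η, Continuous (D η) := fun η =>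
    ((hc.inv₀ fun x => (hpos x).ne').smul hDc).sub
      ((innerSL ℝ (E := EuclideanSpace ℝ (Fin n))).continuous.const_smul (2 * η))
  have hDlog : ∀ η x, HasFDerivAt (fun y => Real.log (h y * w η y)) (D η x) x := fun η x => by
    have e : (fun y => Real.log (h y * w η y)) = fun y => Real.log (h y) - η * ‖y‖ ^ 2 := by
      ext y
      rw [Real.log_mul (hpos y).ne' (hw η y).ne', Real.log_exp]
      ring
    rw [e]
    have := ((hD x).log (hpos x).ne').sub
      ((hasStrictFDerivAt_norm_sq x).hasFDerivAt.const_mul η)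
    refine this.congr_fderiv ?_
    refine ContinuousLinearMap.ext fun v => ?_
    simp only [D, sub_apply, smul_apply, smul_eq_mul, nsmul_eq_mul, Nat.cast_ofNat]
    ring
  -- The gradient of `log w` grows linearly, but `η ‖x‖² w ≤ 1` keeps the Fisher integrand bounded
  -- uniformly in `η ≤ 1`.
  have hDb : ∀ η ∈ Set.Ioc (0 : ℝ) 1, ∀ x, ‖D η x‖ ^ 2 * (h x * w η x)
      ≤ M * (2 * (δ⁻¹ * K) ^ 2 + 8) := fun η hη x => by
    have hη0 := hη.1
    have h1 : ‖D η x‖ ≤ δ⁻¹ * K + 2 * η * ‖x‖ := by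
      refine (norm_sub_le _ _).trans (add_le_add ?_ ?_)
      · rw [norm_smul, norm_inv, Real.norm_of_nonneg (hpos x).le]
        gcongr
        exacts [(hmem x).1, hK x]
      · rw [norm_smul, innerSL_apply_norm, Real.norm_of_nonneg (by positivity)]
    have h2 : ‖D η x‖ ^ 2 ≤ 2 * (δ⁻¹ * K) ^ 2 + 8 * η * (η * ‖x‖ ^ 2) := by
      calc ‖D η x‖ ^ 2 ≤ (δ⁻¹ * K + 2 * η * ‖x‖) ^ 2 := by gcongr
        _ ≤ _ := by nlinarith [sq_nonneg (δ⁻¹ * K - 2 * η * ‖x‖)]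
    calc ‖D η x‖ ^ 2 * (h x * w η x)
        ≤ (2 * (δ⁻¹ * K) ^ 2 + 8 * η * (η * ‖x‖ ^ 2)) * (M * w η x) := by
          have := hw η x
          have := (hpos x).le
          gcongr
          exact (hmem x).2
      _ = M * (2 * (δ⁻¹ * K) ^ 2 * w η x + 8 * η * (η * ‖x‖ ^ 2 * w η x)) := by ring
      _ ≤ M * (2 * (δ⁻¹ * K) ^ 2 * 1 + 8 * 1 * 1) := by
          gcongr
          exacts [hw1 η hη0.le x, hη.2, hwx η x]
      _ = _ := by ring
  have hhw : ∀ η, 0 ≤ η → ∀ x, h x * w η x ∈ Set.Icc 0 M := fun η hη x =>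
    ⟨(mul_pos (hpos x) (hw η x)).le,
      (mul_le_of_le_one_right (hpos x).le (hw1 η hη x)).trans (hmem x).2⟩
  have hmain : ∀ η ∈ Set.Ioc (0 : ℝ) 1,
      ∫ x, h x * w η x * Real.log (h x * w η x) ∂ν
        - (∫ x, h x * w η x ∂ν) * Real.log (∫ x, h x * w η x ∂ν)
      ≤ 1 / (2 * β) * ∫ x, ‖D η x‖ ^ 2 * (h x * w η x) ∂ν := fun η hη => by
    refine hν.entropy_le (h := fun x => h x * w η x) (D := D η) (M := M)
      (C := M * (2 * (δ⁻¹ * K) ^ 2 + 8)) (C' := M * η⁻¹)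
      ?_ (fun x => mul_pos (hpos x) (hw η x)) (fun x => (hhw η hη.1.le x).2) (hDlog η) (hDcont η)
      (hDb η hη) fun x => ?_
    · exact hsm.mul (contDiff_const.mul (contDiff_norm_sq ℝ)).neg.exp
    · have hη0 := hη.1
      have := hwx η x
      have h3 : ‖x‖ ^ 2 * w η x ≤ η⁻¹ := by
        rw [← one_div, le_div_iff₀ hη0]; linarith
      calc ‖x‖ ^ 2 * (h x * w η x) = h x * (‖x‖ ^ 2 * w η x) := by ring
        _ ≤ M * η⁻¹ := by gcongr; exact (hmem x).2
  have hev : ∀ᶠ η in 𝓝[>] (0 : ℝ), η ∈ Set.Ioc (0 : ℝ) 1 := Ioc_mem_nhdsGT one_pos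
  have hwc : ∀ η, Continuous (w η) := fun η => by fun_prop
  have hwη : ∀ x, Tendsto (fun η => w η x) (𝓝[>] 0) (𝓝 1) := fun x => by
    have : Continuous fun η => w η x := by fun_prop
    have h0 := this.tendsto 0
    simp only [w, zero_mul, neg_zero, Real.exp_zero] at h0
    exact h0.mono_left nhdsWithin_le_nhds
  have hhη : ∀ x, Tendsto (fun η => h x * w η x) (𝓝[>] 0) (𝓝 (h x)) := fun x => by
    simpa using (hwη x).const_mul (h x)
  obtain ⟨B, hB⟩ := (isCompact_Icc (a := 0) (b := M)).exists_bound_of_continuousOn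
    Real.continuous_mul_log.continuousOn
  have L1 : Tendsto (fun η => ∫ x, h x * w η x * Real.log (h x * w η x) ∂ν) (𝓝[>] 0)
      (𝓝 (∫ x, h x * Real.log (h x) ∂ν)) := by
    refine tendsto_integral_filter_of_dominated_convergence (fun _ => B)
      (Eventually.of_forall fun η =>
        (Real.continuous_mul_log.comp (hc.mul (hwc η))).aestronglyMeasurable)
      (hev.mono fun η hη => Eventually.of_forall fun x => hB _ (hhw η hη.1.le x))
      (integrable_const _) (Eventually.of_forall fun x => ?_)
    exact (Real.continuous_mul_log.tendsto (h x)).comp (hhη x)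
  have L2 : Tendsto (fun η => ∫ x, h x * w η x ∂ν) (𝓝[>] 0) (𝓝 (∫ x, h x ∂ν)) := by
    refine tendsto_integral_filter_of_dominated_convergence (fun _ => M)
      (Eventually.of_forall fun η => (hc.mul (hwc η)).aestronglyMeasurable)
      (hev.mono fun η hη => Eventually.of_forall fun x => ?_)
      (integrable_const _) (Eventually.of_forall fun x => hhη x)
    rw [Real.norm_of_nonneg (hhw η hη.1.le x).1]
    exact (hhw η hη.1.le x).2
  have L3 : Tendsto (fun η => ∫ x, ‖D η x‖ ^ 2 * (h x * w η x) ∂ν) (𝓝[>] 0)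
      (𝓝 (∫ x, ‖h' x‖ ^ 2 / h x ∂ν)) := by
    refine tendsto_integral_filter_of_dominated_convergence
      (fun _ => M * (2 * (δ⁻¹ * K) ^ 2 + 8))
      (Eventually.of_forall fun η =>
        (((hDcont η).norm.pow 2).mul (hc.mul (hwc η))).aestronglyMeasurable)
      (hev.mono fun η hη => Eventually.of_forall fun x => ?_)
      (integrable_const _) (Eventually.of_forall fun x => ?_)
    · rw [Real.norm_of_nonneg (mul_nonneg (sq_nonneg _) (hhw η hη.1.le x).1)]
      exact hDb η hη x
    · have hDη : Tendsto (fun η => D η x) (𝓝[>] 0) (𝓝 ((h x)⁻¹ • h' x)) := by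
        have : Continuous fun η => D η x := by fun_prop
        have h0 := this.tendsto 0
        simp only [D, mul_zero, zero_smul, sub_zero] at h0
        exact h0.mono_left nhdsWithin_le_nhds
      have e : ‖h' x‖ ^ 2 / h x = ‖(h x)⁻¹ • h' x‖ ^ 2 * h x := by
        have := (hpos x).ne'
        rw [norm_smul, norm_inv, Real.norm_of_nonneg (hpos x).le]
        field_simp
      rw [e]
      exact (hDη.norm.pow 2).mul (hhη x)
  refine le_of_tendsto_of_tendsto
    (L1.sub ((Real.continuous_mul_log.tendsto (∫ x, h x ∂ν)).comp L2)) (L3.const_mul _)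
    (hev.mono hmain)

/-- The log-Sobolev inequality for smooth densities extends to `C¹` functions. -/
theorem LogSobolev.c1LogSobolev {n : ℕ} {ν : Measure (EuclideanSpace ℝ (Fin n))}
    [IsProbabilityMeasure ν] {β : ℝ} (hν : LogSobolev ν β) : C1LogSobolev ν (1 / (2 * β)) := by
  intro h h' δ M K hδ hmem hD hDc hK
  have hpos : ∀ x, 0 < h x := fun x => hδ.trans_le (hmem x).1
  have hc : Continuous h := continuous_iff_continuousAt.2 fun x => (hD x).continuousAt
  have hM : ∀ x, ‖h x‖ ≤ M := fun x => by
    rw [Real.norm_of_nonneg (hpos x).le]; exact (hmem x).2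
  let φ : ℕ → ContDiffBump (0 : EuclideanSpace ℝ (Fin n)) := fun k =>
    ⟨1 / (k + 1) / 2, 1 / (k + 1), by positivity, half_lt_self (by positivity)⟩
  have hφ : Tendsto (fun k => (φ k).rOut) atTop (𝓝 0) := tendsto_one_div_add_atTop_nhds_zero_nat
  let P : ℕ → Measure (EuclideanSpace ℝ (Fin n)) := fun k =>
    volume.withDensity fun x => ENNReal.ofReal ((φ k).normed volume x)
  have hnm : ∀ k, Measurable fun x => ENNReal.ofReal ((φ k).normed volume x) := fun k =>
    (φ k).continuous_normed.measurable.ennreal_ofReal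
  have hP : ∀ k, IsProbabilityMeasure (P k) := fun k => ⟨by
    rw [withDensity_apply _ MeasurableSet.univ, Measure.restrict_univ,
      ← ofReal_integral_eq_lintegral_ofReal (φ k).integrable_normed
        (Eventually.of_forall fun x => (φ k).nonneg_normed x), (φ k).integral_normed,
      ENNReal.ofReal_one]⟩
  -- The mollification has two readings: as an average over random translations it inherits the
  -- bounds and the derivative of `h`, and as a convolution with a bump it is smooth and converges
  -- pointwise.
  have hconv : ∀ {F : Type} [NormedAddCommGroup F] [NormedSpace ℝ F] [CompleteSpace F]
      (G : EuclideanSpace ℝ (Fin n) → F) k x,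
      ∫ t, G (x + -t) ∂(P k) = ((φ k).normed volume ⋆[ContinuousLinearMap.lsmul ℝ ℝ, volume] G) x :=
    fun {F} _ _ _ G k x => by
      rw [integral_withDensity_eq_integral_toReal_smul (hnm k)
        (Eventually.of_forall fun _ => ENNReal.ofReal_lt_top), convolution_def]
      refine integral_congr_ae (Eventually.of_forall fun t => ?_)
      simp only [ENNReal.toReal_ofReal ((φ k).nonneg_normed t), ContinuousLinearMap.lsmul_apply,
        sub_eq_add_neg]
  let H : ℕ → EuclideanSpace ℝ (Fin n) → ℝ := fun k x => ∫ t, h (x + -t) ∂(P k)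
  let H' : ℕ → EuclideanSpace ℝ (Fin n) → EuclideanSpace ℝ (Fin n) →L[ℝ] ℝ := fun k x =>
    ∫ t, h' (x + -t) ∂(P k)
  have hHd : ∀ k x, HasFDerivAt (H k) (H' k x) x := fun k x =>
    hasFDerivAt_integral_translate (P k) measurable_neg hD hDc hM hK x
  have hHs : ∀ k, ContDiff ℝ (⊤ : ℕ∞) (H k) := fun k => by
    have e : H k = (φ k).normed volume ⋆[ContinuousLinearMap.lsmul ℝ ℝ, volume] h :=
      funext fun x => hconv h k x
    rw [e]
    exact (φ k).hasCompactSupport_normed.contDiff_convolution_left _ (φ k).contDiff_normed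
      hc.locallyIntegrable
  have hHi : ∀ k x, Integrable (fun t => h (x + -t)) (P k) := fun k x =>
    Integrable.of_bound (Continuous.aestronglyMeasurable (by fun_prop)) M
      (Eventually.of_forall fun t => hM _)
  have hHmem : ∀ k x, H k x ∈ Set.Icc δ M := fun k x => by
    constructor
    · simpa using! integral_mono (integrable_const δ) (hHi k x) fun t => (hmem (x + -t)).1
    · simpa using! integral_mono (hHi k x) (integrable_const M) fun t => (hmem (x + -t)).2
  have hH'b : ∀ k x, ‖H' k x‖ ≤ K := fun k x => by
    simpa using norm_integral_le_of_norm_le_const (μ := P k)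
      (Eventually.of_forall fun t => hK (x + -t))
  have hH'c : ∀ k, Continuous (H' k) := fun k =>
    continuous_of_dominated (fun _ => Continuous.aestronglyMeasurable (by fun_prop))
      (fun _ => Eventually.of_forall fun _ => hK _) (integrable_const K)
      (Eventually.of_forall fun _ => by fun_prop)
  have hHlim : ∀ x, Tendsto (fun k => H k x) atTop (𝓝 (h x)) := fun x => by
    simp only [H, hconv h]
    exact ContDiffBump.convolution_tendsto_right_of_continuous hφ hc x
  have hH'lim : ∀ x, Tendsto (fun k => H' k x) atTop (𝓝 (h' x)) := fun x => by
    simp only [H', hconv h']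
    exact ContDiffBump.convolution_tendsto_right_of_continuous hφ hDc x
  obtain ⟨B, hB⟩ := (isCompact_Icc (a := δ) (b := M)).exists_bound_of_continuousOn
    Real.continuous_mul_log.continuousOn
  have hHc : ∀ k, Continuous (H k) := fun k => (hHs k).continuous
  have hHpos : ∀ k x, 0 < H k x := fun k x => hδ.trans_le (hHmem k x).1
  have L1 : Tendsto (fun k => ∫ x, H k x * Real.log (H k x) ∂ν) atTop
      (𝓝 (∫ x, h x * Real.log (h x) ∂ν)) :=
    tendsto_integral_of_dominated_convergence (fun _ => B)
      (fun k => (Real.continuous_mul_log.comp (hHc k)).aestronglyMeasurable)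
      (integrable_const _) (fun k => Eventually.of_forall fun x => hB _ (hHmem k x))
      (Eventually.of_forall fun x => (Real.continuous_mul_log.tendsto (h x)).comp (hHlim x))
  have L2 : Tendsto (fun k => ∫ x, H k x ∂ν) atTop (𝓝 (∫ x, h x ∂ν)) :=
    tendsto_integral_of_dominated_convergence (fun _ => M)
      (fun k => (hHc k).aestronglyMeasurable)
      (integrable_const _) (fun k => Eventually.of_forall fun x => by
        rw [Real.norm_of_nonneg (hHpos k x).le]; exact (hHmem k x).2)
      (Eventually.of_forall hHlim)
  have L3 : Tendsto (fun k => ∫ x, ‖H' k x‖ ^ 2 / H k x ∂ν) atTop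
      (𝓝 (∫ x, ‖h' x‖ ^ 2 / h x ∂ν)) :=
    tendsto_integral_of_dominated_convergence (fun _ => K ^ 2 / δ)
      (fun k => (((hH'c k).norm.pow 2).div (hHc k) fun x => (hHpos k x).ne').aestronglyMeasurable)
      (integrable_const _) (fun k => Eventually.of_forall fun x => by
        have := hHpos k x
        rw [Real.norm_of_nonneg (by positivity)]
        gcongr
        exacts [hH'b k x, (hHmem k x).1])
      (Eventually.of_forall fun x => ((hH'lim x).norm.pow 2).div (hHlim x) (hpos x).ne')
  exact le_of_tendsto_of_tendsto'
    (L1.sub ((Real.continuous_mul_log.tendsto (∫ x, h x ∂ν)).comp L2)) (L3.const_mul _)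
    fun k => hν.entropy_le_of_contDiff hδ (hHs k) (hHmem k) (hHd k) (hH'c k) (hH'b k)

end FromSmooth

/-! ### Contraction of density moments under simultaneous Gaussian smoothing. -/

section Contraction

set_option linter.unusedSectionVars false
set_option maxSynthPendingDepth 3
variable {E : Type*} [NormedAddCommGroup E] [InnerProductSpace ℝ E] [FiniteDimensional ℝ E]
  [MeasurableSpace E] [BorelSpace E]

/-- The law of `X + s Z`, where `X` has law `ρ` and `Z` is an independent standard Gaussian. -/
noncomputable def gaussConv (s : ℝ) (ρ : Measure E) : Measure E :=
  (ρ.prod (stdGaussian E)).map fun p => p.1 + s • p.2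

theorem measurable_add_smul (s : ℝ) : Measurable fun p : E × E => p.1 + s • p.2 :=
  Continuous.measurable (by fun_prop)

instance isProbabilityMeasure_gaussConv (s : ℝ) (ρ : Measure E) [IsProbabilityMeasure ρ] :
    IsProbabilityMeasure (gaussConv s ρ) :=
  Measure.isProbabilityMeasure_map (measurable_add_smul s).aemeasurable

theorem gaussConv_absolutelyContinuous {ρ ν : Measure E} (h : ρ ≪ ν) (s : ℝ) :
    gaussConv s ρ ≪ gaussConv s ν :=
  (h.prod Measure.AbsolutelyContinuous.rfl).map (measurable_add_smul s)

theorem integral_gaussConv {ρ : Measure E} [IsProbabilityMeasure ρ] {g : E → ℝ}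
    (hg : Continuous g) {C : ℝ} (hC : ∀ x, ‖g x‖ ≤ C) (s : ℝ) :
    ∫ x, g x ∂(gaussConv s ρ) = ∫ x, gaussAvg s g x ∂ρ := by
  rw [gaussConv, integral_map (measurable_add_smul s).aemeasurable hg.aestronglyMeasurable,
    integral_prod_translate ρ hg hC]

theorem lintegral_gaussConv {ρ : Measure E} [IsProbabilityMeasure ρ] {g : E → ℝ}
    (hg : Continuous g) {C : ℝ} (hC : ∀ x, ‖g x‖ ≤ C) (h0 : ∀ x, 0 ≤ g x) (s : ℝ) :
    ∫⁻ x, ENNReal.ofReal (g x) ∂(gaussConv s ρ) = ENNReal.ofReal (∫ x, gaussAvg s g x ∂ρ) := by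
  rw [← integral_gaussConv hg hC, ofReal_integral_eq_lintegral_ofReal
    (Integrable.of_bound hg.aestronglyMeasurable C (Eventually.of_forall hC))
    (Eventually.of_forall h0)]

/-- A smooth compactly supported function is regularised to a positive function. -/
theorem exists_boundedC2_sqrt {φ : E → ℝ} (hφ : ContDiff ℝ (⊤ : ℕ∞) φ) (hc : HasCompactSupport φ)
    {ε : ℝ} (hε : 0 < ε) :
    ∃ g' g'' M K, BoundedC2 (fun x => √(φ x ^ 2 + ε ^ 2)) g' g'' ε M K := by
  have hφ2 : ContDiff ℝ 2 φ := contDiff_infty.1 hφ 2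
  have hφ1 : ContDiff ℝ 1 (fderiv ℝ φ) := hφ2.fderiv_right (by norm_num)
  have hφ0 : Continuous (fderiv ℝ (fderiv ℝ φ)) := hφ1.continuous_fderiv (by norm_num)
  obtain ⟨B, hB⟩ := hφ.continuous.bounded_above_of_compact_support hc
  obtain ⟨B₁, hB₁⟩ := hφ1.continuous.bounded_above_of_compact_support (hc.fderiv ℝ)
  obtain ⟨B₂, hB₂⟩ := hφ0.bounded_above_of_compact_support ((hc.fderiv ℝ).fderiv ℝ)
  have hC2 : BoundedC2 φ (fderiv ℝ φ) (fderiv ℝ (fderiv ℝ φ)) (-B) B (max B₁ B₂) :=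
    { mem_Icc := fun x => abs_le.1 (hB x)
      hasFDerivAt := fun x => (hφ2.differentiable (by norm_num) x).hasFDerivAt
      hasFDerivAt' := fun x => (hφ1.differentiable (by norm_num) x).hasFDerivAt
      continuous'' := hφ0
      bound' := fun x => (hB₁ x).trans (le_max_left _ _)
      bound'' := fun x => (hB₂ x).trans (le_max_right _ _) }
  have hpos : ∀ u : ℝ, 0 < u ^ 2 + ε ^ 2 := fun u => by positivity
  have hd : ∀ u : ℝ, HasDerivAt (fun u => √(u ^ 2 + ε ^ 2)) (u / √(u ^ 2 + ε ^ 2)) u := fun u => by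
    have h1 : HasDerivAt (fun u : ℝ => u ^ 2 + ε ^ 2) (2 * u) u := by
      simpa using ((hasDerivAt_id u).pow 2).add_const (ε ^ 2)
    refine (h1.sqrt (hpos u).ne').congr_deriv ?_
    have := Real.sqrt_pos.2 (hpos u)
    field_simp
  obtain ⟨V', C, hV⟩ := hC2.exists_comp (ψ := fun u => √(u ^ 2 + ε ^ 2)) (δ' := ε)
    (M' := √(B ^ 2 + ε ^ 2)) (fun u _ => hd u)
    (fun u _ => (hasDerivAt_id u).div (hd u) (Real.sqrt_pos.2 (hpos u)).ne')
    (Continuous.continuousOn (by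
      refine Continuous.div ?_ ?_ fun u => pow_ne_zero 2 (Real.sqrt_pos.2 (hpos u)).ne'
      · refine (continuous_const.mul (by fun_prop)).sub (continuous_id.mul ?_)
        exact continuous_id.div (by fun_prop) fun u => (Real.sqrt_pos.2 (hpos u)).ne'
      · fun_prop))
    (fun u hu => ⟨Real.le_sqrt_of_sq_le (by nlinarith [sq_nonneg u]),
      Real.sqrt_le_sqrt (by nlinarith [hu.1, hu.2])⟩)
  exact ⟨_, V', _, C, hV⟩

/-- Norm inequalities that hold for regular positive functions hold for all nonnegative functions. -/
theorem eLpNorm_le_of_boundedC2 {ρ μ : Measure E} [IsProbabilityMeasure ρ] [IsProbabilityMeasure μ]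
    {r : ℝ} (hr : 1 < r) {N : ℝ≥0∞} (hN : N ≠ ⊤)
    (H : ∀ (g : E → ℝ) (g' : E → E →L[ℝ] ℝ) (g'' : E → E →L[ℝ] E →L[ℝ] ℝ) (δ M K : ℝ), 0 < δ →
      BoundedC2 g g' g'' δ M K →
      eLpNorm g 1 ρ ≤ N * eLpNorm g (ENNReal.ofReal r) μ)
    {g : E → ℝ} (hg : Measurable g) (h0 : ∀ x, 0 ≤ g x) {B : ℝ} (hB : ∀ x, g x ≤ B) :
    eLpNorm g 1 ρ ≤ N * eLpNorm g (ENNReal.ofReal r) μ := by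
  set p := ENNReal.ofReal r with hp
  have hp1 : 1 ≤ p := by rw [hp, ← ENNReal.ofReal_one]; exact ENNReal.ofReal_le_ofReal hr.le
  -- Approximating in `L^p(ρ + μ)` yields one function that is close to `g` for both measures.
  have hgL : MemLp g p (ρ + μ) := MemLp.of_bound hg.aestronglyMeasurable B
    (Eventually.of_forall fun x => by rw [Real.norm_of_nonneg (h0 x)]; exact hB x)
  set U : ℝ≥0∞ := 1 + (ρ + μ) Set.univ ^ (1 / p.toReal) with hU
  have hUtop : U ≠ ⊤ := ENNReal.add_ne_top.2 ⟨ENNReal.one_ne_top,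
    ENNReal.rpow_ne_top_of_nonneg (by positivity) (measure_ne_top _ _)⟩
  have key : ∀ ε : ℝ, 0 < ε → eLpNorm g 1 ρ
      ≤ N * (eLpNorm g p μ + ENNReal.ofReal ε * U) + ENNReal.ofReal ε * U := fun ε hε => by
    obtain ⟨φ, hφc, hφ, hφε⟩ := hgL.exist_eLpNorm_sub_le ENNReal.ofReal_ne_top hp1 hε
    obtain ⟨g', g'', M, K, hC2⟩ := exists_boundedC2_sqrt hφ hφc hε
    -- `G` lies between `|φ|` and `|φ| + ε`, so the positive floor costs at most `ε`; replacing `φ`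
    -- by `|φ|` costs nothing because `g ≥ 0`.
    set G : E → ℝ := fun x => √(φ x ^ 2 + ε ^ 2) with hG
    have hGm : Measurable G := hC2.continuous.measurable
    have hpt : ∀ x, ‖(g - G) x‖ ≤ ‖(g - φ) x‖ + ‖ε‖ := fun x => by
      have h1 : |φ x| ≤ G x := Real.abs_le_sqrt (by nlinarith)
      have h2 : G x ≤ |φ x| + ε := by
        refine Real.sqrt_le_iff.2 ⟨by positivity, ?_⟩
        nlinarith [abs_nonneg (φ x), sq_abs (φ x)]
      have h3 : |g x - (|φ x|)| ≤ |g x - φ x| := by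
        have := abs_abs_sub_abs_le_abs_sub (g x) (φ x)
        rwa [abs_of_nonneg (h0 x)] at this
      simp only [Pi.sub_apply, Real.norm_eq_abs, abs_of_pos hε]
      calc |g x - G x| ≤ |g x - (|φ x|)| + |(|φ x|) - G x| := abs_sub_le _ _ _
        _ ≤ |g x - φ x| + ε := by
          gcongr
          rw [abs_le]; constructor <;> linarith
    have hd : eLpNorm (g - G) p (ρ + μ) ≤ ENNReal.ofReal ε * U := by
      calc eLpNorm (g - G) p (ρ + μ)
          ≤ eLpNorm ((fun x => ‖(g - φ) x‖) + fun _ => ‖ε‖) p (ρ + μ) :=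
            eLpNorm_mono_real hpt
        _ ≤ eLpNorm (fun x => ‖(g - φ) x‖) p (ρ + μ) + eLpNorm (fun _ => ‖ε‖) p (ρ + μ) :=
            eLpNorm_add_le (by
              have : Measurable (g - φ) := hg.sub hφ.continuous.measurable
              exact this.norm.aestronglyMeasurable) aestronglyMeasurable_const hp1
        _ ≤ ENNReal.ofReal ε + ENNReal.ofReal ε * (ρ + μ) Set.univ ^ (1 / p.toReal) := by
            gcongr
            · rw [eLpNorm_norm]; exact hφε
            · rw [eLpNorm_const _ (by positivity) (by
                intro h
                have : (ρ + μ) Set.univ = 0 := by rw [h]; simp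
                simp at this)]
              rw [enorm_norm, ← ofReal_norm, Real.norm_of_nonneg hε.le]
        _ = _ := by rw [hU, mul_add, mul_one]
    have hdm : AEStronglyMeasurable (g - G) ρ := (hg.sub hGm).aestronglyMeasurable
    have hd1 : eLpNorm (g - G) 1 ρ ≤ ENNReal.ofReal ε * U :=
      (eLpNorm_le_eLpNorm_of_exponent_le hp1 hdm).trans
        ((eLpNorm_le_add_measure_right _ _ _).trans hd)
    have hd2 : eLpNorm (G - g) p μ ≤ ENNReal.ofReal ε * U := by
      rw [eLpNorm_sub_comm]
      refine le_trans ?_ hd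
      rw [add_comm ρ μ]
      exact eLpNorm_le_add_measure_right _ _ _
    calc eLpNorm g 1 ρ = eLpNorm (G + (g - G)) 1 ρ := by rw [add_sub_cancel]
      _ ≤ eLpNorm G 1 ρ + eLpNorm (g - G) 1 ρ :=
          eLpNorm_add_le hGm.aestronglyMeasurable hdm le_rfl
      _ ≤ N * eLpNorm G p μ + ENNReal.ofReal ε * U :=
          add_le_add (H G g' g'' ε M K hε hC2) hd1
      _ = N * eLpNorm (g + (G - g)) p μ + ENNReal.ofReal ε * U := by rw [add_sub_cancel]
      _ ≤ N * (eLpNorm g p μ + ENNReal.ofReal ε * U) + ENNReal.ofReal ε * U := by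
          gcongr
          exact (eLpNorm_add_le hg.aestronglyMeasurable
            (hGm.sub hg).aestronglyMeasurable hp1).trans (add_le_add_right hd2 _)
  have hlim : Tendsto (fun ε : ℝ => N * (eLpNorm g p μ + ENNReal.ofReal ε * U)
      + ENNReal.ofReal ε * U) (𝓝[>] 0) (𝓝 (N * (eLpNorm g p μ + 0 * U) + 0 * U)) := by
    have h1 : Tendsto (fun ε : ℝ => ENNReal.ofReal ε * U) (𝓝[>] 0) (𝓝 (0 * U)) := by
      refine ENNReal.Tendsto.mul_const ?_ (Or.inr hUtop)
      have := (ENNReal.continuous_ofReal.tendsto 0).mono_left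
        (nhdsWithin_le_nhds (s := Set.Ioi (0 : ℝ)))
      rwa [ENNReal.ofReal_zero] at this
    exact (ENNReal.Tendsto.const_mul (tendsto_const_nhds.add h1) (Or.inr hN)).add h1
  have := ge_of_tendsto hlim (eventually_mem_nhdsWithin.mono fun ε hε => key ε hε)
  simpa using this

/-- The `L^Q` norm of a density by duality. -/
theorem lintegral_rnDeriv_rpow_le_of_dual {α : Type*} [MeasurableSpace α] {ρ μ : Measure α}
    [IsProbabilityMeasure ρ] [IsProbabilityMeasure μ] (hac : ρ ≪ μ) {Q r : ℝ} (hQ : 1 < Q)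
    (hr : r = Q / (Q - 1)) {N : ℝ≥0∞}
    (H : ∀ (g : α → ℝ) (B : ℝ), Measurable g → (∀ x, 0 ≤ g x) → (∀ x, g x ≤ B) →
      eLpNorm g 1 ρ ≤ N * eLpNorm g (ENNReal.ofReal r) μ) :
    ∫⁻ x, ρ.rnDeriv μ x ^ Q ∂μ ≤ N ^ Q := by
  have hQ1 : 0 < Q - 1 := by linarith
  have hQ0 : 0 < Q := by linarith
  have hr0 : 0 < r := by rw [hr]; positivity
  set k := ρ.rnDeriv μ with hk
  have hkm : Measurable k := Measure.measurable_rnDeriv ρ μ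
  -- Truncating the density makes its moment finite, so that a power of it can be cancelled;
  -- monotone convergence removes the truncation.
  let t : ℕ → α → ℝ≥0∞ := fun j x => min (k x) j
  have htm : ∀ j, Measurable (t j) := fun j => hkm.min measurable_const
  have htt : ∀ j x, t j x ≠ ⊤ := fun j x =>
    ((min_le_right _ _).trans_lt (ENNReal.natCast_lt_top j)).ne
  have hI : ∀ j, ∫⁻ x, t j x ^ Q ∂μ ≤ N ^ Q := fun j => by
    set I := ∫⁻ x, t j x ^ Q ∂μ with hIdef
    have hItop : I ≠ ⊤ := by
      have : I ≤ ∫⁻ x, (j : ℝ≥0∞) ^ Q ∂μ := lintegral_mono fun x => by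
        gcongr
        exact min_le_right _ _
      refine ne_top_of_le_ne_top ?_ this
      simp only [lintegral_const, measure_univ, mul_one]
      exact ENNReal.rpow_ne_top_of_nonneg hQ0.le (ENNReal.natCast_ne_top j)
    -- This is the extremal test function `k^(Q-1)` of Hölder's inequality, truncated.
    let g : α → ℝ := fun x => (t j x).toReal ^ (Q - 1)
    have hgm : Measurable g := ((htm j).ennreal_toReal).pow_const _
    have hg0 : ∀ x, 0 ≤ g x := fun x => by positivity
    have hge : ∀ x, ‖g x‖ₑ = t j x ^ (Q - 1) := fun x => by
      rw [← ofReal_norm, Real.norm_of_nonneg (hg0 x),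
        ← ENNReal.ofReal_rpow_of_nonneg ENNReal.toReal_nonneg hQ1.le,
        ENNReal.ofReal_toReal (htt j x)]
    have hgB : ∀ x, g x ≤ (j : ℝ) ^ (Q - 1) := fun x => by
      refine Real.rpow_le_rpow ENNReal.toReal_nonneg ?_ hQ1.le
      exact ENNReal.toReal_le_of_le_ofReal (by positivity) (by
        rw [ENNReal.ofReal_natCast]; exact min_le_right _ _)
    have h := H g _ hgm hg0 hgB
    rw [eLpNorm_one_eq_lintegral_enorm, eLpNorm_eq_lintegral_rpow_enorm_toReal
      (by simpa using hr0) ENNReal.ofReal_ne_top, ENNReal.toReal_ofReal hr0.le] at h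
    simp only [hge, ← ENNReal.rpow_mul] at h
    rw [show (Q - 1) * r = Q by rw [hr]; field_simp, ← lintegral_rnDeriv_mul hac
      ((htm j).pow_const _).aemeasurable] at h
    have hle : I ≤ ∫⁻ x, k x * t j x ^ (Q - 1) ∂μ := lintegral_mono fun x => by
      have : t j x ^ Q = t j x * t j x ^ (Q - 1) := by
        conv_lhs => rw [show Q = 1 + (Q - 1) by ring]
        rw [ENNReal.rpow_add_of_nonneg _ _ zero_le_one hQ1.le, ENNReal.rpow_one]
      show t j x ^ Q ≤ _
      rw [this]
      gcongr
      exact min_le_left _ _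
    have hI2 : I ≤ N * I ^ (1 / r) := hle.trans h
    by_cases hI0 : I = 0
    · rw [hI0]; exact zero_le
    · have e : I = I ^ (1 / Q) * I ^ (1 / r) := by
        rw [← ENNReal.rpow_add _ _ hI0 hItop]
        have : 1 / Q + 1 / r = 1 := by rw [hr]; field_simp; ring
        rw [this, ENNReal.rpow_one]
      have hc0 : I ^ (1 / r) ≠ 0 := by
        simp [ENNReal.rpow_eq_zero_iff, hI0, hItop]
      have hct : I ^ (1 / r) ≠ ⊤ := ENNReal.rpow_ne_top_of_nonneg (by positivity) hItop
      have hI3 : I ^ (1 / Q) ≤ N := by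
        rw [← ENNReal.mul_le_mul_iff_left hc0 hct, ← e]
        exact hI2
      calc I = (I ^ (1 / Q)) ^ Q := by
            rw [← ENNReal.rpow_mul, one_div_mul_cancel hQ0.ne', ENNReal.rpow_one]
        _ ≤ N ^ Q := by gcongr
  have hlim := lintegral_tendsto_of_tendsto_of_monotone (μ := μ) (f := fun j x => t j x ^ Q)
    (F := fun x => k x ^ Q) (fun j => ((htm j).pow_const _).aemeasurable)
    (Eventually.of_forall fun x i j hij => by
      simp only [t]; gcongr)
    (Eventually.of_forall fun x => by
      refine (ENNReal.continuous_rpow_const.tendsto (k x)).comp ?_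
      have h1 := (tendsto_const_nhds (x := k x)).min ENNReal.tendsto_nat_nhds_top
      rwa [min_eq_left le_top] at h1)
  exact le_of_tendsto' hlim hI

/-- Hölder between the first moment, which is `1`, and the `Q`-th: `a = (1 - l) + l Q` for `l = (a -
1) / (Q - 1)`. -/
theorem lintegral_rnDeriv_rpow_interpolate {α : Type*} [MeasurableSpace α] {ρ ν : Measure α}
    [IsProbabilityMeasure ρ] [IsProbabilityMeasure ν] (hac : ρ ≪ ν) {a Q : ℝ} (ha : 1 ≤ a)
    (haQ : a ≤ Q) (hQ : 1 < Q) :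
    ∫⁻ x, ρ.rnDeriv ν x ^ a ∂ν ≤ (∫⁻ x, ρ.rnDeriv ν x ^ Q ∂ν) ^ ((a - 1) / (Q - 1)) := by
  have hQ1 : 0 < Q - 1 := by linarith
  have hkm : Measurable (ρ.rnDeriv ν) := Measure.measurable_rnDeriv ρ ν
  have hl : (a - 1) / (Q - 1) ≤ 1 := (div_le_one hQ1).2 (by linarith)
  have hl0 : 0 ≤ (a - 1) / (Q - 1) := div_nonneg (by linarith) hQ1.le
  have h := ENNReal.lintegral_mul_norm_pow_le (μ := ν) hkm.aemeasurable
    (hkm.pow_const Q).aemeasurable (sub_nonneg.2 hl) hl0 (sub_add_cancel _ _)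
  rw [Measure.lintegral_rnDeriv hac, measure_univ, ENNReal.one_rpow, one_mul] at h
  refine le_trans (le_of_eq (lintegral_congr fun x => ?_)) h
  rw [← ENNReal.rpow_mul, ← ENNReal.rpow_add_of_nonneg _ _ (sub_nonneg.2 hl) (by positivity)]
  congr 1
  field_simp
  ring

/-- Hölder against the constant `1`, since a density has integral one. It gives the sign of the
Rényi divergence and lets exponents of the moment be enlarged. -/
theorem one_le_lintegral_rnDeriv_rpow {α : Type*} [MeasurableSpace α] {ρ ν : Measure α}
    [IsProbabilityMeasure ρ] [IsProbabilityMeasure ν] (hac : ρ ≪ ν) {Q : ℝ} (hQ : 1 < Q) :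
    1 ≤ ∫⁻ x, ρ.rnDeriv ν x ^ Q ∂ν := by
  have hkm : Measurable (ρ.rnDeriv ν) := Measure.measurable_rnDeriv ρ ν
  have hQ0 : 0 < Q := by linarith
  have h := ENNReal.lintegral_mul_norm_pow_le (μ := ν) (f := fun _ => 1) aemeasurable_const
    (hkm.pow_const Q).aemeasurable (p := 1 - 1 / Q) (q := 1 / Q)
    (by rw [sub_nonneg, div_le_one hQ0]; exact hQ.le) (by positivity) (sub_add_cancel _ _)
  simp only [ENNReal.one_rpow, one_mul, lintegral_const, measure_univ, ← ENNReal.rpow_mul,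
    mul_one_div_cancel hQ0.ne', ENNReal.rpow_one, Measure.lintegral_rnDeriv hac] at h
  simpa [← ENNReal.rpow_mul, inv_mul_cancel₀ hQ0.ne'] using ENNReal.rpow_le_rpow h hQ0.le

/-- Contraction of the moments of the density under simultaneous Gaussian smoothing. -/
theorem C1LogSobolev.lintegral_rnDeriv_gaussConv_le {ρ ν : Measure E} [IsProbabilityMeasure ρ]
    [IsProbabilityMeasure ν] {c T Q : ℝ} (hc : 0 < c) (hν : C1LogSobolev ν c) (hT : 0 < T)
    (hac : ρ ≪ ν) (hQ : 1 < Q) :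
    ∫⁻ x, (gaussConv √(2 * T) ρ).rnDeriv (gaussConv √(2 * T) ν) x ^ Q ∂(gaussConv √(2 * T) ν)
      ≤ (∫⁻ x, ρ.rnDeriv ν x ^ Q ∂ν) ^ (Q / (Q + T / c)) := by
  have hQ0 : 0 < Q := by linarith
  have hQ1 : 0 < Q - 1 := by linarith
  have hQ1' := hQ1.ne'
  have hTc : 0 < T / c := by positivity
  set A := ∫⁻ x, ρ.rnDeriv ν x ^ Q ∂ν with hA
  by_cases hAtop : A = ⊤
  · rw [hAtop, ENNReal.top_rpow_of_pos (by positivity)]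
    exact le_top
  set r := Q / (Q - 1) with hr
  have hr1 : 1 < r := by rw [hr, one_lt_div hQ1]; linarith
  have hr' : r - 1 = 1 / (Q - 1) := by rw [hr]; field_simp; ring
  set s := 1 + (r - 1) * (c + T) / c with hs
  have hs' : s - 1 = (1 + T / c) / (Q - 1) := by
    rw [hs, hr']; field_simp; ring
  have hs1 : 1 < s := by
    have : 0 < s - 1 := by rw [hs']; positivity
    linarith
  -- The conjugate exponent of `s`. Since `s > r`, it is smaller than `Q`, the conjugate of `r`;
  -- this gap is the source of the contraction.
  set a := 1 + (Q - 1) / (1 + T / c) with haDef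
  have ha1 : 1 < a := by
    have : 0 < (Q - 1) / (1 + T / c) := by positivity
    linarith
  have haQ : a ≤ Q := by
    have : (Q - 1) / (1 + T / c) ≤ Q - 1 := div_le_self hQ1.le (by linarith)
    linarith
  have hsa : s.HolderConjugate a := by
    rw [Real.holderConjugate_iff]
    refine ⟨hs1, ?_⟩
    have e : s = 1 + (1 + T / c) / (Q - 1) := by linarith
    rw [e, haDef]
    have : 0 < 1 + T / c := by linarith
    have : 1 + T / c + (Q - 1) ≠ 0 := by positivity
    have h2 : (1 + (1 + T / c) / (Q - 1))⁻¹ = (Q - 1) / (1 + T / c + (Q - 1)) := by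
      rw [inv_eq_iff_eq_inv, inv_div]
      rw [eq_div_iff hQ1.ne', add_mul, div_mul_cancel₀ _ hQ1.ne']; ring
    have h3 : (1 + (Q - 1) / (1 + T / c))⁻¹ = (1 + T / c) / (1 + T / c + (Q - 1)) := by
      rw [inv_eq_iff_eq_inv, inv_div]
      rw [eq_div_iff (by positivity), add_mul, div_mul_cancel₀ _ (by positivity)]; ring
    rw [h2, h3, ← add_div, add_comm (Q - 1), div_self this]
  set N : ℝ≥0∞ := (∫⁻ x, ρ.rnDeriv ν x ^ a ∂ν) ^ (1 / a) with hN
  have hNA : N ≤ A ^ ((a - 1) / (Q - 1) * (1 / a)) := by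
    rw [hN, ENNReal.rpow_mul]
    exact ENNReal.rpow_le_rpow (lintegral_rnDeriv_rpow_interpolate hac ha1.le haQ hQ)
      (by positivity)
  have hNtop : N ≠ ⊤ := ne_top_of_le_ne_top
    (ENNReal.rpow_ne_top_of_nonneg (mul_nonneg (div_nonneg (by linarith) hQ1.le) (by positivity))
      hAtop) hNA
  have hkm : Measurable (ρ.rnDeriv ν) := Measure.measurable_rnDeriv ρ ν
  have hnice : ∀ (g : E → ℝ) (g' : E → E →L[ℝ] ℝ) (g'' : E → E →L[ℝ] E →L[ℝ] ℝ) (δ M K : ℝ),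
      0 < δ → BoundedC2 g g' g'' δ M K →
      eLpNorm g 1 (gaussConv √(2 * T) ρ)
        ≤ N * eLpNorm g (ENNReal.ofReal r) (gaussConv √(2 * T) ν) := by
    intro g g' g'' δ M K hδ h
    have hhyp := hν.hypercontractive hc hT h hδ hr1 hs
    have hb := h.gaussAvg √(2 * T)
    have hgpos : ∀ x, 0 < g x := fun x => hδ.trans_le (h.mem_Icc x).1
    have hupos : ∀ x, 0 < gaussAvg √(2 * T) g x := fun x => hδ.trans_le (hb.mem_Icc x).1
    have hrc : Continuous fun y => g y ^ r :=
      h.continuous.rpow_const fun y => Or.inl (hgpos y).ne'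
    obtain ⟨C, hC⟩ := isCompact_Icc.exists_bound_of_continuousOn (s := Set.Icc δ M)
      (f := fun v : ℝ => v ^ r)
      (continuousOn_id.rpow_const fun v hv => Or.inl (hδ.trans_le hv.1).ne')
    obtain ⟨C', hC'⟩ := isCompact_Icc.exists_bound_of_continuousOn (s := Set.Icc δ M)
      (f := fun v : ℝ => v ^ s)
      (continuousOn_id.rpow_const fun v hv => Or.inl (hδ.trans_le hv.1).ne')
    have hen : ∀ x, ‖g x‖ₑ = ENNReal.ofReal (g x) := fun x => by
      rw [← ofReal_norm, Real.norm_of_nonneg (hgpos x).le]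
    rw [eLpNorm_one_eq_lintegral_enorm, eLpNorm_eq_lintegral_rpow_enorm_toReal
      (by simpa using (by linarith : 0 < r)) ENNReal.ofReal_ne_top,
      ENNReal.toReal_ofReal (by linarith)]
    simp only [hen]
    have e1 : ∀ x, ENNReal.ofReal (g x) ^ r = ENNReal.ofReal (g x ^ r) := fun x =>
      ENNReal.ofReal_rpow_of_nonneg (hgpos x).le (by linarith)
    simp only [e1]
    rw [lintegral_gaussConv h.continuous h.norm_le (fun x => (hgpos x).le),
      lintegral_gaussConv hrc (fun x => hC _ (h.mem_Icc x)) (fun x => (Real.rpow_pos_of_pos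
        (hgpos x) r).le),
      ofReal_integral_eq_lintegral_ofReal (integrable_gaussAvg ρ h.continuous h.norm_le _)
        (Eventually.of_forall fun x => (hupos x).le),
      ← lintegral_rnDeriv_mul hac hb.continuous.measurable.ennreal_ofReal.aemeasurable]
    -- Smoothing is moved from `ρ` to the test function, Hölder under `ν` separates the density in
    -- `L^a` from the averaged function in `L^s`, and hypercontractivity replaces the latter by the
    -- `L^r` norm of `g` under the smoothed `ν`.
    have hH := ENNReal.lintegral_mul_le_Lp_mul_Lq ν hsa.symm hkm.aemeasurable
      hb.continuous.measurable.ennreal_ofReal.aemeasurable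
    refine hH.trans ?_
    gcongr
    have e2 : ∀ x, ENNReal.ofReal (gaussAvg √(2 * T) g x) ^ s
        = ENNReal.ofReal (gaussAvg √(2 * T) g x ^ s) := fun x =>
      ENNReal.ofReal_rpow_of_nonneg (hupos x).le (by linarith)
    have hsc : Continuous fun x => gaussAvg √(2 * T) g x ^ s :=
      hb.continuous.rpow_const fun y => Or.inl (hupos y).ne'
    simp only [e2]
    have hnn : 0 ≤ ∫ x, gaussAvg √(2 * T) (fun y => g y ^ r) x ∂ν := integral_nonneg fun x =>
      integral_nonneg fun z => (Real.rpow_pos_of_pos (hgpos _) r).le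
    rw [← ofReal_integral_eq_lintegral_ofReal
      (Integrable.of_bound hsc.aestronglyMeasurable C'
        (Eventually.of_forall fun x => hC' _ (hb.mem_Icc x)))
      (Eventually.of_forall fun x => (Real.rpow_pos_of_pos (hupos x) s).le),
      ENNReal.ofReal_rpow_of_nonneg (integral_nonneg fun x =>
        (Real.rpow_pos_of_pos (hupos x) s).le) (by positivity),
      ENNReal.ofReal_rpow_of_nonneg hnn (by positivity)]
    exact ENNReal.ofReal_le_ofReal hhyp
  have hdual := lintegral_rnDeriv_rpow_le_of_dual (gaussConv_absolutelyContinuous hac √(2 * T)) hQ hr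
    (N := N) fun g B hg h0 hB => eLpNorm_le_of_boundedC2 hr1 hNtop hnice hg h0 hB
  -- The exponent `Q (a - 1) / (a (Q - 1))` equals `Q / (Q + T/c)`.
  refine hdual.trans ((ENNReal.rpow_le_rpow hNA hQ0.le).trans (le_of_eq ?_))
  rw [← ENNReal.rpow_mul]
  congr 1
  rw [haDef]
  have h1 : 0 < 1 + T / c := by linarith
  have h2 : 1 + (Q - 1) / (1 + T / c) = (Q + T / c) / (1 + T / c) := by
    rw [eq_div_iff h1.ne', add_mul, div_mul_cancel₀ _ h1.ne']; ring
  have h3 : 0 < Q + T / c := by positivity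
  rw [h2]
  rw [show (Q + T / c) / (1 + T / c) - 1 = (Q - 1) / (1 + T / c) by
    rw [← h2]; ring]
  set y := T / c
  field_simp

end Contraction

/-! ### Change of variables and change of reference measure for density moments. -/

section Embedding

variable {α β : Type*} [MeasurableSpace α] [MeasurableSpace β]

theorem absolutelyContinuous_of_map {T : α → β} (hT : MeasurableEmbedding T) {ρ μ : Measure α}
    (h : ρ.map T ≪ μ.map T) : ρ ≪ μ := by
  refine Measure.AbsolutelyContinuous.mk fun s hs h0 => ?_
  have h1 := h (s := T '' s) (by
    rw [hT.map_apply, Set.preimage_image_eq _ hT.injective, h0])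
  rwa [hT.map_apply, Set.preimage_image_eq _ hT.injective] at h1

/-- Moments of densities are invariant under injective changes of variables. -/
theorem lintegral_rnDeriv_map_rpow {T : α → β} (hT : MeasurableEmbedding T) (ρ μ : Measure α)
    [SigmaFinite ρ] [SigmaFinite μ] (Q : ℝ) :
    ∫⁻ y, (ρ.map T).rnDeriv (μ.map T) y ^ Q ∂(μ.map T) = ∫⁻ x, ρ.rnDeriv μ x ^ Q ∂μ := by
  rw [hT.lintegral_map]
  exact lintegral_congr_ae ((hT.rnDeriv_map ρ μ).mono fun x hx => by simp only [hx])

/-- A weak triangle inequality for the moments of densities. -/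
theorem lintegral_rnDeriv_rpow_le_mul {ρ μ ν : Measure α} [IsProbabilityMeasure ρ]
    [IsProbabilityMeasure μ] [IsProbabilityMeasure ν] (hρ : ρ ≪ μ) (hμ : μ ≪ ν) {q : ℝ}
    (hq : 1 < q) :
    ∫⁻ x, ρ.rnDeriv ν x ^ q ∂ν ≤ (∫⁻ x, ρ.rnDeriv μ x ^ (2 * q) ∂μ) ^ (1 / 2 : ℝ)
      * (∫⁻ x, μ.rnDeriv ν x ^ (2 * q - 1) ∂ν) ^ (1 / 2 : ℝ) := by
  have hk : Measurable (ρ.rnDeriv μ) := Measure.measurable_rnDeriv ρ μ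
  have hm : Measurable (μ.rnDeriv ν) := Measure.measurable_rnDeriv μ ν
  set a := ρ.rnDeriv μ
  set b := μ.rnDeriv ν
  -- By the chain rule `dρ/dν = a b`, and one factor `b` is absorbed by `dμ = b dν`. Cauchy–Schwarz
  -- under `μ` then separates `a^(2q)` from `b^(2(q-1))`, and returning to `ν` raises the last
  -- exponent to `2q - 1`.
  have e1 : ∫⁻ x, ρ.rnDeriv ν x ^ q ∂ν = ∫⁻ x, a x ^ q * b x ^ (q - 1) ∂μ := by
    have hkm : Measurable fun x => a x ^ q * b x ^ (q - 1) :=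
      (hk.pow_const _).mul (hm.pow_const _)
    rw [← lintegral_rnDeriv_mul hμ hkm.aemeasurable]
    refine lintegral_congr_ae ?_
    filter_upwards [Measure.rnDeriv_mul_rnDeriv hρ (κ := ν)] with x hx
    have hb : b x ^ q = b x * b x ^ (q - 1) := by
      nth_rewrite 2 [← ENNReal.rpow_one (b x)]
      rw [← ENNReal.rpow_add_of_nonneg _ _ zero_le_one (by linarith)]
      congr 1; ring
    rw [← hx, Pi.mul_apply, ENNReal.mul_rpow_of_nonneg _ _ (by linarith), hb]
    ring
  have e2 : ∫⁻ x, b x ^ (2 * q - 1) ∂ν = ∫⁻ x, b x ^ (2 * (q - 1)) ∂μ := by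
    rw [← lintegral_rnDeriv_mul hμ (hm.pow_const _).aemeasurable]
    refine lintegral_congr fun x => ?_
    show _ = b x * _
    nth_rewrite 2 [← ENNReal.rpow_one (b x)]
    rw [← ENNReal.rpow_add_of_nonneg _ _ zero_le_one (by linarith)]
    congr 1; ring
  rw [e1, e2]
  have h := ENNReal.lintegral_mul_le_Lp_mul_Lq μ Real.HolderConjugate.two_two
    (hk.pow_const q).aemeasurable (hm.pow_const (q - 1)).aemeasurable
  simp only [← ENNReal.rpow_mul, Pi.mul_apply] at h
  simpa only [mul_comm (2 : ℝ)] using h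

end Embedding

/-! ### The algorithm step, stationarity of the biased limit, and iteration. -/

section Iteration

set_option linter.unusedSectionVars false
set_option maxSynthPendingDepth 3
variable {n : ℕ} {f : EuclideanSpace ℝ (Fin n) → ℝ} {L ε : ℝ}

theorem IsSmooth.continuous_gradient (hL : 0 ≤ L) (hf : IsSmooth f L) :
    Continuous (gradient f) :=
  (LipschitzWith.of_dist_le_mul (K := ⟨L, hL⟩) fun x y => by
    rw [dist_eq_norm, dist_eq_norm]; exact hf.2 x y).continuous

/-- Injective because `ε ∇f` is Lipschitz with constant `εL < 1`; a continuous injection between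
Polish spaces is a measurable embedding. -/
theorem IsSmooth.measurableEmbedding (hL : 0 < L) (hf : IsSmooth f L) (hε : 0 < ε)
    (hεL : ε < 1 / L) : MeasurableEmbedding fun x => x + ε • gradient f x := by
  have hc := hf.continuous_gradient hL.le
  refine Continuous.measurableEmbedding (by fun_prop) fun x y hxy => ?_
  have h1 : x - y = ε • (gradient f y - gradient f x) := by
    rw [smul_sub, sub_eq_sub_iff_add_eq_add, hxy]
    exact add_comm _ _
  have h2 : ‖x - y‖ ≤ ε * L * ‖x - y‖ := by
    nth_rewrite 1 [h1]
    rw [norm_smul, Real.norm_of_nonneg hε.le, norm_sub_rev, mul_assoc]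
    exact mul_le_mul_of_nonneg_left (hf.2 x y) hε.le
  have h3 : ε * L < 1 := (lt_div_iff₀ hL).1 hεL
  have h4 : ‖x - y‖ = 0 := by nlinarith [norm_nonneg (x - y)]
  exact sub_eq_zero.1 (norm_eq_zero.1 h4)

/-- The implicit step is solved for the past: `x (k+1) + ε ∇f(x (k+1)) = x k + √(2ε) z k`, with `z
k` independent of `x k`. -/
theorem IsPLA.map_step {Ω : Type*} [MeasurableSpace Ω] {P : Measure Ω} [IsProbabilityMeasure P]
    {x z : ℕ → Ω → EuclideanSpace ℝ (Fin n)} (hx : IsPLA f ε P x z)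
    (hc : Continuous (gradient f)) (k : ℕ) :
    (P.map (x (k + 1))).map (fun y => y + ε • gradient f y)
      = gaussConv √(2 * ε) (P.map (x k)) := by
  have hT : Measurable fun y : EuclideanSpace ℝ (Fin n) => y + ε • gradient f y :=
    Continuous.measurable (by fun_prop)
  have hind : IndepFun (x k) (z k) P :=
    (hx.indep_noise k).comp (φ := fun v : Fin (k + 1) → EuclideanSpace ℝ (Fin n) => v (Fin.last k))
      (ψ := id) (measurable_pi_apply (Fin.last k)) measurable_id
  rw [gaussConv, ← hx.law_noise k, ← hind.map_prod_eq_prod_map_map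
    (hx.measurable_iterate k).aemeasurable (hx.measurable_noise k).aemeasurable,
    Measure.map_map hT (hx.measurable_iterate _),
    Measure.map_map (measurable_add_smul _)
      ((hx.measurable_iterate k).prodMk (hx.measurable_noise k))]
  refine Measure.map_congr ((hx.step k).mono fun w hw => ?_)
  simp only [Function.comp_apply]
  nth_rewrite 1 [hw]
  abel

/-- The laws of `x k` and `x (k+1)` have the same weak limit. Composition with the step map and
Gaussian averaging both preserve bounded continuous functions, so the one-step relation passes to
the limit. -/
theorem IsBiasedLimit.map_eq {νε : Measure (EuclideanSpace ℝ (Fin n))} [IsProbabilityMeasure νε]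
    (h : IsBiasedLimit f ε νε) (hc : Continuous (gradient f)) :
    νε.map (fun y => y + ε • gradient f y) = gaussConv √(2 * ε) νε := by
  obtain ⟨Ω, _, P, _, x, z, hx, hlim⟩ := h
  have hTc : Continuous fun y : EuclideanSpace ℝ (Fin n) => y + ε • gradient f y := by fun_prop
  have hp : ∀ k, IsProbabilityMeasure (P.map (x k)) := fun k =>
    Measure.isProbabilityMeasure_map (hx.measurable_iterate k).aemeasurable
  have := Measure.isProbabilityMeasure_map (μ := νε) hTc.measurable.aemeasurable
  refine ext_of_forall_integral_eq_of_IsFiniteMeasure fun g => ?_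
  have hg : ∀ y, ‖g y‖ ≤ ‖g‖ := g.norm_coe_le_norm
  have h1 := (tendsto_add_atTop_iff_nat 1).2 (hlim (g.compContinuous ⟨_, hTc⟩))
  have h2 := hlim (BoundedContinuousFunction.ofNormedAddCommGroup (gaussAvg √(2 * ε) g)
    (continuous_gaussAvg_right g.continuous hg _) ‖g‖ (norm_gaussAvg_le hg _))
  rw [integral_map hTc.measurable.aemeasurable g.continuous.aestronglyMeasurable,
    integral_gaussConv g.continuous hg]
  refine tendsto_nhds_unique h1 (h2.congr fun k => ?_)
  simp only [BoundedContinuousFunction.coe_ofNormedAddCommGroup,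
    BoundedContinuousFunction.compContinuous_apply, ContinuousMap.coe_mk]
  rw [← integral_gaussConv g.continuous hg, ← hx.map_step hc k,
    integral_map hTc.measurable.aemeasurable g.continuous.aestronglyMeasurable]

/-- With `t = y / Q ≤ 1`, one has `e^t ≤ 1 + t + t² ≤ 1 + 2t`. -/
theorem div_add_le_exp_neg {Q y : ℝ} (hQ : 0 < Q) (hy : 0 ≤ y) (hyQ : y ≤ Q) :
    Q / (Q + 2 * y) ≤ Real.exp (-(y / Q)) := by
  set t := y / Q with ht
  have ht0 : 0 ≤ t := by positivity
  have ht1 : t ≤ 1 := (div_le_one hQ).2 hyQ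
  have h1 : Real.exp t ≤ 1 + 2 * t := by
    have := Real.abs_exp_sub_one_sub_id_le (x := t) (by rwa [abs_of_nonneg ht0])
    have := (abs_le.1 this).2
    nlinarith
  have h2 : Q / (Q + 2 * y) = (1 + 2 * t)⁻¹ := by
    rw [ht]; field_simp
  rw [h2, Real.exp_neg]
  exact inv_anti₀ (Real.exp_pos t) h1

theorem IsPLA.lintegral_rnDeriv_step {β Q : ℝ} {νε : Measure (EuclideanSpace ℝ (Fin n))}
    [IsProbabilityMeasure νε] (hL : 0 < L) (hf : IsSmooth f L) (hε : 0 < ε) (hεL : ε < 1 / L)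
    (hlim : IsBiasedLimit f ε νε) (hLSI : LogSobolev νε β) (hQ : 1 < Q) (hβε : β * ε ≤ Q)
    {Ω : Type*} [MeasurableSpace Ω] {P : Measure Ω} [IsProbabilityMeasure P]
    {x z : ℕ → Ω → EuclideanSpace ℝ (Fin n)} (hx : IsPLA f ε P x z) {k : ℕ}
    (hac : P.map (x k) ≪ νε) :
    P.map (x (k + 1)) ≪ νε ∧ ∫⁻ y, (P.map (x (k + 1))).rnDeriv νε y ^ Q ∂νε
      ≤ (∫⁻ y, (P.map (x k)).rnDeriv νε y ^ Q ∂νε) ^ Real.exp (-(β * ε / Q)) := by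
  have hp : ∀ k, IsProbabilityMeasure (P.map (x k)) := fun k =>
    Measure.isProbabilityMeasure_map (hx.measurable_iterate k).aemeasurable
  have hT := hf.measurableEmbedding hL hε hεL
  have hc := hf.continuous_gradient hL.le
  have hβ : 0 < β := hLSI.1
  refine ⟨absolutelyContinuous_of_map hT ?_, ?_⟩
  · rw [hx.map_step hc k, hlim.map_eq hc]
    exact gaussConv_absolutelyContinuous hac _
  · rw [← lintegral_rnDeriv_map_rpow hT, hx.map_step hc k, hlim.map_eq hc]
    refine (hLSI.c1LogSobolev.lintegral_rnDeriv_gaussConv_le (by positivity) hε hac hQ).trans ?_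
    -- The moment is at least `1`, so a larger exponent gives a larger bound.
    refine ENNReal.rpow_le_rpow_of_exponent_le (one_le_lintegral_rnDeriv_rpow hac hQ) ?_
    -- Here `T / c = 2βε`, as `c = 1/(2β)`, so `y = βε`.
    convert div_add_le_exp_neg (by linarith) (by positivity) hβε using 3
    rw [one_div, div_inv_eq_mul]; ring

theorem IsPLA.lintegral_rnDeriv_le {β Q : ℝ} {νε : Measure (EuclideanSpace ℝ (Fin n))}
    [IsProbabilityMeasure νε] (hL : 0 < L) (hf : IsSmooth f L) (hε : 0 < ε) (hεL : ε < 1 / L)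
    (hlim : IsBiasedLimit f ε νε) (hLSI : LogSobolev νε β) (hQ : 1 < Q) (hβε : β * ε ≤ Q)
    {Ω : Type*} [MeasurableSpace Ω] {P : Measure Ω} [IsProbabilityMeasure P]
    {x z : ℕ → Ω → EuclideanSpace ℝ (Fin n)} (hx : IsPLA f ε P x z)
    (hac : P.map (x 0) ≪ νε) (k : ℕ) :
    P.map (x k) ≪ νε ∧ ∫⁻ y, (P.map (x k)).rnDeriv νε y ^ Q ∂νε
      ≤ (∫⁻ y, (P.map (x 0)).rnDeriv νε y ^ Q ∂νε) ^ Real.exp (-(β * ε * k / Q)) := by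
  induction k with
  | zero => simpa using hac
  | succ k ih =>
    obtain ⟨h1, h2⟩ := hx.lintegral_rnDeriv_step hL hf hε hεL hlim hLSI hQ hβε ih.1
    refine ⟨h1, h2.trans ((ENNReal.rpow_le_rpow ih.2 (Real.exp_pos _).le).trans (le_of_eq ?_))⟩
    rw [← ENNReal.rpow_mul, ← Real.exp_add]
    congr 2
    push_cast
    ring

/-! ### From density moments to Rényi divergences. -/

theorem renyiDiv_nonneg {q : ℝ} (hq : 1 < q) (ν ρ : Measure (EuclideanSpace ℝ (Fin n)))
    [IsProbabilityMeasure ν] [IsProbabilityMeasure ρ] : 0 ≤ renyiDiv q ν ρ := by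
  rw [renyiDiv]
  split_ifs with hac
  · have : 0 < q - 1 := by linarith
    refine mul_nonneg (EReal.coe_nonneg.2 (by positivity)) ?_
    rw [← ENNReal.log_one]
    exact ENNReal.log_monotone (one_le_lintegral_rnDeriv_rpow hac hq)
  · exact le_top

/-- A weak triangle inequality for Rényi divergences. -/
theorem renyiDiv_le_add {q θ : ℝ} (hq : 1 < q) (hθ : 0 < θ)
    {ν μ ρ ρ₀ : Measure (EuclideanSpace ℝ (Fin n))} [IsProbabilityMeasure ν]
    [IsProbabilityMeasure μ] [IsProbabilityMeasure ρ] [IsProbabilityMeasure ρ₀]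
    (h : ρ₀ ≪ μ → ρ ≪ μ ∧ ∫⁻ x, ρ.rnDeriv μ x ^ (2 * q) ∂μ
      ≤ (∫⁻ x, ρ₀.rnDeriv μ x ^ (2 * q) ∂μ) ^ θ) :
    renyiDiv q ν ρ ≤ (((q - 1 / 2) / (q - 1) : ℝ) : EReal) * renyiDiv (2 * q) μ ρ₀
      * (θ : EReal) + renyiDiv (2 * q - 1) ν μ := by
  have hq1 : 0 < q - 1 := by linarith
  have hc : 0 < (q - 1 / 2) / (q - 1) := div_pos (by linarith) hq1
  -- If absolute continuity fails, a term on the right is `⊤`, and nonnegativity of the other term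
  -- excludes adding `⊥` to it.
  by_cases hρ₀ : ρ₀ ≪ μ
  swap
  · have h1 : renyiDiv (2 * q) μ ρ₀ = ⊤ := if_neg hρ₀
    rw [h1, EReal.coe_mul_top_of_pos hc, EReal.top_mul_coe_of_pos hθ, EReal.top_add_of_ne_bot]
    · exact le_top
    · exact ne_bot_of_le_ne_bot EReal.zero_ne_bot (renyiDiv_nonneg (by linarith) ν μ)
  by_cases hμ : μ ≪ ν
  swap
  · have h1 : renyiDiv (2 * q - 1) ν μ = ⊤ := if_neg hμ
    rw [h1, EReal.add_top_of_ne_bot]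
    · exact le_top
    · exact ne_bot_of_le_ne_bot EReal.zero_ne_bot (mul_nonneg (mul_nonneg
        (EReal.coe_nonneg.2 hc.le) (renyiDiv_nonneg (by linarith) μ ρ₀))
        (EReal.coe_nonneg.2 hθ.le))
  obtain ⟨hρ, hle⟩ := h hρ₀
  rw [renyiDiv, renyiDiv, renyiDiv, if_pos (hρ.trans hμ), if_pos hρ₀, if_pos hμ]
  have key := (lintegral_rnDeriv_rpow_le_mul hρ hμ hq).trans
    (mul_le_mul_left (ENNReal.rpow_le_rpow hle (by norm_num : (0 : ℝ) ≤ 1 / 2)) _)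
  set A := ∫⁻ x, ρ₀.rnDeriv μ x ^ (2 * q) ∂μ
  set B := ∫⁻ x, μ.rnDeriv ν x ^ (2 * q - 1) ∂ν
  have hlog := ENNReal.log_monotone key
  rw [ENNReal.log_mul_add, ← ENNReal.rpow_mul, ENNReal.log_rpow, ENNReal.log_rpow] at hlog
  refine (mul_le_mul_of_nonneg_left hlog (EReal.coe_nonneg.2 (by positivity))).trans
    (le_of_eq ?_)
  rw [EReal.left_distrib_of_nonneg_of_ne_top (EReal.coe_nonneg.2 (by positivity))
    (EReal.coe_ne_top _), ← mul_assoc, ← mul_assoc, ← mul_assoc, mul_right_comm _ _ (θ : EReal)]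
  simp only [← EReal.coe_mul]
  -- The halves from Cauchy–Schwarz meet the normalisations `1/(2q-1)` and `1/(2q-2)` of the two
  -- divergences; the first produces the factor `(q - 1/2)/(q - 1)`, the second a factor one.
  congr 3
  · have : q * 2 - 1 ≠ 0 := by linarith
    rw [show q - 1 / 2 = (2 * q - 1) / 2 by ring]
    field_simp
  · rw [show 2 * q - 1 - 1 = 2 * (q - 1) by ring]
    field_simp

end Iteration

theorem theorem2 {n : ℕ} (f : EuclideanSpace ℝ (Fin n) → ℝ) (L β ε q : ℝ)
    (νε : Measure (EuclideanSpace ℝ (Fin n)))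
    (hν : IsProbabilityMeasure (gibbs f))
    (hL : 0 < L) (hf : IsSmooth f L)
    (hε : 0 < ε) (hεlt : ε < min (1 / L) (1 / (2 * β)))
    (hνε : IsProbabilityMeasure νε) (hlim : IsBiasedLimit f ε νε)
    (hLSI : LogSobolev νε β) (hq : 1 < q)
    {Ω : Type*} [MeasurableSpace Ω] (P : Measure Ω) [IsProbabilityMeasure P]
    (x z : ℕ → Ω → EuclideanSpace ℝ (Fin n)) (hx : IsPLA f ε P x z) (k : ℕ) :
    renyiDiv q (gibbs f) (P.map (x k)) ≤
      (((q - 1 / 2) / (q - 1) : ℝ) : EReal) * renyiDiv (2 * q) νε (P.map (x 0))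
          * ((Real.exp (-(β * ε * k) / (2 * q)) : ℝ) : EReal)
        + renyiDiv (2 * q - 1) (gibbs f) νε := by
  have hp : ∀ k, IsProbabilityMeasure (P.map (x k)) := fun k =>
    Measure.isProbabilityMeasure_map (hx.measurable_iterate k).aemeasurable
  obtain ⟨hεL, hεβ⟩ := lt_min_iff.1 hεlt
  have hβ : 0 < β := hLSI.1
  -- The step-size bound gives `βε < 1/2`, within the range `y ≤ Q` of the exponential estimate at
  -- `Q = 2q`.
  have hβε : β * ε ≤ 2 * q := by
    have := (lt_div_iff₀ (by positivity)).1 hεβ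
    nlinarith
  refine renyiDiv_le_add hq (Real.exp_pos _) fun hac => ?_
  rw [neg_div]
  exact hx.lintegral_rnDeriv_le hL hf hε hεL hlim hLSI (by linarith) hβε hac k
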